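/- Let $\lambda>0$ and $R\ge 0$ be real numbers. Let $H=\begin{pmatrix}1&0\\0&-1\end{pmatrix}$, $X=\begin{pmatrix}0&1\\0&0\end{pmatrix}$, $Y=\begin{pmatrix}0&0\\1&0\end{pmatrix}$ be the standard basis of $\mathfrak{sl}_2(\mathbb C)$ and let $\mathbb S^2_\lambda=\{k\mu k^{-1} : k\in SU(2)\}$ be the adjoint orbit of $SU(2)$ through $\mu=\frac{\mathrm i\lambda}{8}H$, with projection $\psi\colon SU(2)\to\mathbb S^2_\lambda$, $k\mapsto k\mu k^{-1}$. Let $\mathrm{Pol}(\mathbb S^2_\lambda)$ be the algebra of restrictions to $\mathbb S^2_\lambda$ of complex valued polynomials on $\mathfrak{su}(2)$. Star product. Put $\Omega=\{0,\lambda,\frac\lambda2,\frac\lambda3,\dots\}$. For $\hbar\in\mathbb C\setminus\Omega$ and $p,q\in\mathrm{Pol}(\mathbb S^2_\lambda)$ let $p*_\hbar q\in\mathrm{Pol}(\mathbb S^2_\lambda)$ be determined by $$(p*_\hbar q)\circ\psi=\sum_{n=0}^\infty\frac{(-1)^n\hbar^n}{n!\,\lambda(\lambda-\hbar)\cdots(\lambda-(n-1)\hbar)}\,\bigl((Y^{\mathrm{left}})^n(p\circ\psi)\bigr)\cdot\bigl((X^{\mathrm{left}})^n(q\circ\psi)\bigr),$$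 where $Z\mapsto Z^{\mathrm{left}}$ is the complex linear extension to $\mathfrak{sl}_2(\mathbb C)$ of the map that sends $E\in\mathfrak{su}(2)$ to the left invariant vector field $f\mapsto\bigl(k\mapsto\frac{\mathrm d}{\mathrm dt}\big|_{t=0}f(k\exp(tE))\bigr)$ on $SU(2)$; only finitely many terms of the sum are non-zero. Topology. Let $\hat U,\hat{\overline U},\hat V,\hat{\overline V}$ be the functions $z_1,\overline z_1,z_2,\overline z_2$ on $\mathbb C^2$ and give the algebra of polynomials in them the locally convex topology of the seminorms $\sum_I a_I e^I\mapsto\sum_I(|I|!)^R\,C^{|I|}\,|a_I|$, $C\ge1$, where $e^I$ ($I\in\mathbb N_0^4$) are the monomials in these generators. Give the subalgebra generated by $\hat U\hat{\overline U}-\hat V\hat{\overline V}$, $\hat{\overline U}\hat V$, $\hat U\hat{\overline V}$, $\hat U\hat{\overline U}+\hat V\hat{\overline V}$ the subspace topology, and give its image under restriction to $SU(2)$ (a matrix in $SU(2)$ is sent to its first column in $\mathbb C^2$) the quotient topology. This image is the space of all $p\circ\psi$ with $p\in\mathrm{Pol}(\mathbb S^2_\lambda)$; the resulting topology on $\mathrm{Pol}(\mathbb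 S^2_\lambda)$ is the reduction-$T_R$-topology. Let $\widehat{\mathrm{Pol}}_R(\mathbb S^2_\lambda)$ be the completion. For every $\hbar\in\mathbb C\setminus\Omega$ the product $*_\hbar$ is well defined on $\mathrm{Pol}(\mathbb S^2_\lambda)$ and extends to a continuous map $*_\hbar\colon\widehat{\mathrm{Pol}}_R(\mathbb S^2_\lambda)\times\widehat{\mathrm{Pol}}_R(\mathbb S^2_\lambda)\to\widehat{\mathrm{Pol}}_R(\mathbb S^2_\lambda)$, and for every $x\in\mathbb S^2_\lambda$ the evaluation $p\mapsto p(x)$ extends to a continuous map $\widehat{\mathrm{Pol}}_R(\mathbb S^2_\lambda)\to\mathbb C$, still written $p\mapsto p(x)$. With these extensions, for all $p,q\in\widehat{\mathrm{Pol}}_R(\mathbb S^2_\lambda)$ and all $x\in\mathbb S^2_\lambda$ the function $$\mathbb C\setminus\Omega\to\mathbb C,\qquad \hbar\mapsto(p*_\hbar q)(x)$$ is holomorphic. -/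

import Mathlib

open scoped Matrix Topology

noncomputable section

namespace QuantumSphere

/-! ## The group `SU(2)`, its Lie algebra and left invariant vector fields -/

/-- The group `SU(2)`. -/
abbrev SU2 : Type := Matrix.specialUnitaryGroup (Fin 2) ℂ

/-- The real Lie algebra `su(2)` of trace-free skew-Hermitian `2 × 2` matrices. -/
def su2 : Submodule ℝ (Matrix (Fin 2) (Fin 2) ℂ) where
  carrier := {E | Eᴴ = -E ∧ E.trace = 0}
  zero_mem' := by simp
  add_mem' := by
    rintro E F ⟨hE, hE'⟩ ⟨hF, hF'⟩
    exact ⟨by rw [Matrix.conjTranspose_add, hE, hF]; abel, by simp [hE', hF']⟩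
  smul_mem' := by
    rintro c E ⟨hE, hE'⟩
    exact ⟨by rw [Matrix.conjTranspose_smul, hE]; simp, by simp [hE']⟩

/-- The exponential of a trace-free `2 × 2` matrix has determinant one. -/
theorem det_exp_eq_one (Z : Matrix (Fin 2) (Fin 2) ℂ) (hZ : Z.trace = 0) :
    (NormedSpace.exp Z).det = 1 := by
  set J : Matrix (Fin 2) (Fin 2) ℂ := !![0, 1; -1, 0] with hJ
  have hJdet : J.det = 1 := by simp [hJ, Matrix.det_fin_two]
  have hJunit : IsUnit J := by rw [Matrix.isUnit_iff_isUnit_det, hJdet]; exact isUnit_one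
  have hJinv : J⁻¹ = !![0, -1; 1, 0] := by
    apply Matrix.inv_eq_right_inv
    ext i j; fin_cases i <;> fin_cases j <;> simp [hJ]
  have adj : ∀ A : Matrix (Fin 2) (Fin 2) ℂ, J * Aᵀ * J⁻¹ = A.adjugate := by
    intro A
    rw [hJinv, Matrix.adjugate_fin_two, Matrix.eta_fin_two A, hJ]
    ext i j; fin_cases i <;> fin_cases j <;> simp [Matrix.mul_apply, Matrix.vecMul, dotProduct, Fin.sum_univ_two]
  have hneg : J * Zᵀ * J⁻¹ = -Z := by
    rw [adj, Matrix.adjugate_fin_two]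
    rw [Matrix.trace_fin_two] at hZ
    ext i j; fin_cases i <;> fin_cases j <;> simp
    · linear_combination hZ
    · linear_combination hZ
  have h1 : (NormedSpace.exp Z).adjugate = (NormedSpace.exp Z)⁻¹ := by
    rw [← adj, ← Matrix.exp_transpose, ← Matrix.exp_conj _ _ hJunit, hneg, Matrix.exp_neg]
  have h2 := Matrix.mul_adjugate (NormedSpace.exp Z)
  rw [h1, Matrix.mul_nonsing_inv _
    ((Matrix.isUnit_iff_isUnit_det _).1 (Matrix.isUnit_exp Z))] at h2
  have h3 := congrFun (congrFun h2 0) 0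
  simpa using h3.symm

/-- The exponential map `su(2) → SU(2)`. -/
def expSU (E : su2) : SU2 :=
  ⟨NormedSpace.exp (E : Matrix (Fin 2) (Fin 2) ℂ), by
    rw [Matrix.mem_specialUnitaryGroup_iff]
    refine ⟨?_, det_exp_eq_one _ E.2.2⟩
    rw [Matrix.mem_unitaryGroup_iff, Matrix.star_eq_conjTranspose, ← Matrix.exp_conjTranspose,
      E.2.1, Matrix.exp_neg]
    exact Matrix.mul_nonsing_inv _
      ((Matrix.isUnit_iff_isUnit_det _).1 (Matrix.isUnit_exp _))⟩

/-- The left invariant vector field on `SU(2)` of `E ∈ su(2)`: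
`f ↦ (k ↦ d/dt f (k exp(tE)) at t = 0)`. -/
def leftField (E : su2) (f : SU2 → ℂ) (k : SU2) : ℂ :=
  deriv (fun t : ℝ => f (k * expSU (t • E))) 0

/-- The part `E = (Z - Z*) / 2 ∈ su(2)` in the decomposition `Z = E + i F` of `Z ∈ sl(2, ℂ)`. -/
def partE (Z : Matrix (Fin 2) (Fin 2) ℂ) (hZ : Z.trace = 0) : su2 :=
  ⟨(1 / 2 : ℂ) • (Z - Zᴴ), by simp [Matrix.conjTranspose_smul, ← smul_neg], by
    simp [Matrix.trace_smul, Matrix.trace_conjTranspose, hZ]⟩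

/-- The part `F = -i (Z + Z*) / 2 ∈ su(2)` in the decomposition `Z = E + i F`
of `Z ∈ sl(2, ℂ)`. -/
def partF (Z : Matrix (Fin 2) (Fin 2) ℂ) (hZ : Z.trace = 0) : su2 :=
  ⟨(-Complex.I / 2) • (Z + Zᴴ), by
    rw [Matrix.conjTranspose_smul, ← neg_smul, Matrix.conjTranspose_add,
      Matrix.conjTranspose_conjTranspose, add_comm Zᴴ Z]
    congr 1
    simp [neg_div], by
    simp [Matrix.trace_smul, Matrix.trace_conjTranspose, hZ]⟩

theorem partE_add_I_smul_partF (Z : Matrix (Fin 2) (Fin 2) ℂ) (hZ : Z.trace = 0) :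
    (partE Z hZ : Matrix (Fin 2) (Fin 2) ℂ) + Complex.I • (partF Z hZ).1 = Z := by
  have h : Complex.I * (-Complex.I / 2) = 1 / 2 := by
    rw [mul_div_assoc', mul_neg, Complex.I_mul_I]; norm_num
  simp only [partE, partF, smul_smul, h, ← smul_add]
  rw [sub_add_add_cancel, ← two_smul ℂ Z, smul_smul]; norm_num

/-- The left invariant vector field of `Z = E + i F ∈ sl(2, ℂ)`, `E, F ∈ su(2)`, extended
complex linearly from `su(2)`. -/
def leftFieldC (Z : Matrix (Fin 2) (Fin 2) ℂ) (hZ : Z.trace = 0) (f : SU2 → ℂ) : SU2 → ℂ :=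
  fun k => leftField (partE Z hZ) f k + Complex.I * leftField (partF Z hZ) f k

/-- The left invariant vector field of the basis element `X` of `sl(2, ℂ)`. -/
def leftX : (SU2 → ℂ) → (SU2 → ℂ) :=
  leftFieldC !![0, 1; 0, 0] (by simp [Matrix.trace_fin_two])

/-- The left invariant vector field of the basis element `Y` of `sl(2, ℂ)`. -/
def leftY : (SU2 → ℂ) → (SU2 → ℂ) :=
  leftFieldC !![0, 0; 1, 0] (by simp [Matrix.trace_fin_two])

/-! ## The sphere as an adjoint orbit and its polynomial functions -/

/-- The base point `μ = (i l / 8) H`, for which `B(-iμ, H) = l`, where `B(Z, W) = 4 tr(ZW)` is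
the Killing form of `sl(2, ℂ)`. -/
def basePoint (l : ℝ) : Matrix (Fin 2) (Fin 2) ℂ :=
  (Complex.I * (l : ℂ) / 8) • !![1, 0; 0, -1]

/-- The adjoint orbit of `SU(2)` through `μ`. -/
def Sphere (l : ℝ) : Set (Matrix (Fin 2) (Fin 2) ℂ) :=
  Set.range fun k : SU2 =>
    (k : Matrix (Fin 2) (Fin 2) ℂ) * basePoint l * ((k⁻¹ : SU2) : Matrix (Fin 2) (Fin 2) ℂ)

/-- The orbit projection `ψ : SU(2) → Sphere`, `k ↦ Ad_k μ`. -/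
def psi (l : ℝ) (k : SU2) : Sphere l :=
  ⟨(k : Matrix (Fin 2) (Fin 2) ℂ) * basePoint l * ((k⁻¹ : SU2) : Matrix (Fin 2) (Fin 2) ℂ),
    k, rfl⟩

/-- The restrictions to the sphere of complex valued polynomials on the real vector space that
contains it: the algebra of functions generated by the (restrictions of) real linear maps
with values in `ℂ`. -/
def Pol (l : ℝ) : Subalgebra ℂ (Sphere l → ℂ) :=
  Algebra.adjoin ℂ {f | ∃ φ : Matrix (Fin 2) (Fin 2) ℂ →ₗ[ℝ] ℂ, ∀ x : Sphere l, f x = φ x}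

/-- The right invariant extension `p ∘ ψ` of a function on the sphere to `SU(2)`. -/
def pull (l : ℝ) : (Sphere l → ℂ) →ₐ[ℂ] (SU2 → ℂ) where
  toFun p := p ∘ psi l
  map_one' := rfl
  map_mul' _ _ := rfl
  map_zero' := rfl
  map_add' _ _ := rfl
  commutes' _ := rfl

/-! ## The star product on polynomials -/

/-- The set of poles `{0, l, l/2, l/3, …}`. -/
def poleSet (l : ℝ) : Set ℂ := {0} ∪ {h | ∃ n : ℕ, 1 ≤ n ∧ h = (l : ℂ) / (n : ℂ)}

/-- The coefficient of `Y ^ n ⊗ X ^ n` in `F_ħ`: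
`(-1) ^ n ħ ^ n / (n! l (l - ħ) ⋯ (l - (n - 1) ħ))`. -/
def starCoeff (l : ℝ) (h : ℂ) (n : ℕ) : ℂ :=
  (-1) ^ n * h ^ n / ((n.factorial : ℂ) * ∏ j ∈ Finset.range n, ((l : ℂ) - (j : ℂ) * h))

/-- `F_ħ(p, q)` as a function on `SU(2)`: the bidifferential operator
`∑ n, starCoeff n • Y ^ n ⊗ X ^ n` applied to the right invariant extensions of `p` and `q`.
For polynomials only finitely many terms are non-zero. -/
def starLift (l : ℝ) (h : ℂ) (p q : Pol l) (k : SU2) : ℂ :=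
  ∑' n : ℕ, starCoeff l h n * (leftY^[n] (pull l p)) k * (leftX^[n] (pull l q)) k

open Classical in
/-- The star product `p *_ħ q` of polynomials on the sphere: the polynomial whose right invariant
extension to `SU(2)` is `F_ħ(p, q)`. -/
def starProd (l : ℝ) (h : ℂ) (p q : Pol l) : Pol l :=
  if hr : ∃ r : Pol l, pull l r = starLift l h p q then hr.choose else 0

/-! ## The reduction topology -/

/-- The coordinate functions `U, Ū, V, V̄` on `SU(2)`, where `u, v` are the entries of the first
column. -/
def coord : Fin 4 → SU2 → ℂ :=
  ![fun k => k.1 0 0, fun k => star (k.1 0 0), fun k => k.1 1 0, fun k => star (k.1 1 0)]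

/-- `A = U Ū - V V̄` on `SU(2)`. -/
def fA : SU2 → ℂ := coord 0 * coord 1 - coord 2 * coord 3
/-- `B = Ū V` on `SU(2)`. -/
def fB : SU2 → ℂ := coord 1 * coord 2
/-- `C = U V̄` on `SU(2)`. -/
def fC : SU2 → ℂ := coord 0 * coord 3

/-- The algebra of functions on `SU(2)` generated by `A, B, C`. -/
def InvSU : Subalgebra ℂ (SU2 → ℂ) := Algebra.adjoin ℂ {fA, fB, fC}

/-- The algebra of complex polynomials on the real vector space `ℂ²`, i.e. the symmetric algebra on
the basis `Û, Û̄, V̂, V̂̄` (in this order) of its complexified dual. -/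
abbrev PolC2 : Type := MvPolynomial (Fin 4) ℂ

/-- `Â = Û Û̄ - V̂ V̂̄` on `ℂ²`. -/
def hA : PolC2 := .X 0 * .X 1 - .X 2 * .X 3
/-- `B̂ = Û̄ V̂` on `ℂ²`. -/
def hB : PolC2 := .X 1 * .X 2
/-- `Ĉ = Û V̂̄` on `ℂ²`. -/
def hC : PolC2 := .X 0 * .X 3
/-- `D̂ = Û Û̄ + V̂ V̂̄` on `ℂ²`. -/
def hD : PolC2 := .X 0 * .X 1 + .X 2 * .X 3

/-- The algebra generated by `Â, B̂, Ĉ, D̂`. -/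
def InvC2 : Subalgebra ℂ PolC2 := Algebra.adjoin ℂ {hA, hB, hC, hD}

/-- Restriction of a polynomial on `ℂ²` to `SU(2)`, seen as the unit sphere via the first
column. -/
def restrict : PolC2 →ₐ[ℂ] (SU2 → ℂ) := MvPolynomial.aeval coord

theorem restrict_hD : restrict hD = 1 := by
  funext k
  have h := (Matrix.mem_unitaryGroup_iff'.1 (Matrix.mem_specialUnitaryGroup_iff.1 k.2).1)
  have h0 := congrFun (congrFun h 0) 0
  simp only [Matrix.mul_apply, Fin.sum_univ_two, Matrix.star_apply, Matrix.one_apply_eq] at h0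
  simp only [restrict, hD, coord, map_add, map_mul, MvPolynomial.aeval_X, Pi.add_apply,
    Pi.mul_apply, Pi.one_apply]
  simpa [mul_comm] using h0

theorem map_restrict_InvC2 : InvC2.map restrict = InvSU := by
  have hA' : restrict hA = fA := by simp [restrict, hA, fA]
  have hB' : restrict hB = fB := by simp [restrict, hB, fB]
  have hC' : restrict hC = fC := by simp [restrict, hC, fC]
  rw [InvC2, AlgHom.map_adjoin, InvSU]
  simp only [Set.image_insert_eq, Set.image_singleton, hA', hB', hC', restrict_hD]
  apply le_antisymm
  · apply Algebra.adjoin_le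
    rintro f (rfl | rfl | rfl | rfl)
    · exact Algebra.subset_adjoin (by simp)
    · exact Algebra.subset_adjoin (by simp)
    · exact Algebra.subset_adjoin (by simp)
    · exact one_mem _
  · apply Algebra.adjoin_mono
    rintro f (rfl | rfl | rfl) <;> simp

/-- The restriction map from the algebra generated by `Â, B̂, Ĉ, D̂` to the one generated by
`A, B, C`. -/
def restrictInv : InvC2 →ₐ[ℂ] InvSU :=
  (restrict.comp InvC2.val).codRestrict InvSU fun P => by
    rw [← map_restrict_InvC2]
    exact ⟨P, P.2, rfl⟩

theorem restrictInv_surjective : Function.Surjective restrictInv := by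
  rintro ⟨f, hf⟩
  obtain ⟨P, hP, rfl⟩ := (map_restrict_InvC2 ▸ hf : f ∈ InvC2.map restrict)
  exact ⟨⟨P, hP⟩, rfl⟩

theorem pull_mem_InvSU (l : ℝ) (p : Pol l) : pull l p ∈ InvSU := by
  have key : Pol l ≤ InvSU.comap (pull l) := by
    apply Algebra.adjoin_le
    rintro f ⟨φ, hφ⟩
    have hlin : ∀ (c : SU2 → ℂ) (M : Matrix (Fin 2) (Fin 2) ℂ),
        (fun k => ((c k).re : ℂ)) ∈ InvSU → (fun k => ((c k).im : ℂ)) ∈ InvSU →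
        (fun k => φ (c k • M)) ∈ InvSU := by
      intro c M hre him
      have : (fun k => φ (c k • M)) =
          φ M • (fun k => ((c k).re : ℂ)) + φ (Complex.I • M) • (fun k => ((c k).im : ℂ)) := by
        funext k
        have h1 : c k • M = (c k).re • M + (c k).im • (Complex.I • M) := by
          conv_lhs => rw [← Complex.re_add_im (c k)]
          ext i j
          simp only [Matrix.smul_apply, Matrix.add_apply, smul_eq_mul, Complex.real_smul]
          ring
        rw [h1, map_add, map_smul, map_smul]
        simp [mul_comm]
      rw [this]
      exact add_mem (InvSU.smul_mem hre _) (InvSU.smul_mem him _)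
    have mA : fA ∈ InvSU := Algebra.subset_adjoin (by simp)
    have mB : fB ∈ InvSU := Algebra.subset_adjoin (by simp)
    have mC : fC ∈ InvSU := Algebra.subset_adjoin (by simp)
    have hconj : ∀ k, fC k = star (fB k) := by intro k; simp [fB, fC, coord]
    have hAre : ∀ k, ((fA k).re : ℂ) = fA k := by
      intro k
      apply Complex.conj_eq_iff_re.1
      simp [fA, coord, mul_comm]
    have hAim : ∀ k, (fA k).im = 0 := by
      intro k
      apply Complex.conj_eq_iff_im.1
      simp [fA, coord, mul_comm]
    have mre : (fun k => ((fB k).re : ℂ)) ∈ InvSU := by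
      have : (fun k => ((fB k).re : ℂ)) = (1 / 2 : ℂ) • (fB + fC) := by
        funext k
        have := hconj k
        simp only [Pi.smul_apply, Pi.add_apply, this, smul_eq_mul]
        rw [Complex.re_eq_add_conj]
        simp; ring
      rw [this]
      exact InvSU.smul_mem (add_mem mB mC) _
    have mim : (fun k => ((fB k).im : ℂ)) ∈ InvSU := by
      have : (fun k => ((fB k).im : ℂ)) = (1 / (2 * Complex.I) : ℂ) • (fB - fC) := by
        funext k
        have := hconj k
        simp only [Pi.smul_apply, Pi.sub_apply, this, smul_eq_mul]
        rw [Complex.im_eq_sub_conj, div_eq_inv_mul, one_div]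
        rfl
      rw [this]
      exact InvSU.smul_mem (sub_mem mB mC) _
    have mre' : (fun k => ((fC k).re : ℂ)) ∈ InvSU := by
      have : (fun k => ((fC k).re : ℂ)) = fun k => ((fB k).re : ℂ) := by
        funext k; rw [hconj]; simp
      rw [this]; exact mre
    have mim' : (fun k => ((fC k).im : ℂ)) ∈ InvSU := by
      have : (fun k => ((fC k).im : ℂ)) = -fun k => ((fB k).im : ℂ) := by
        funext k; rw [hconj]; simp
      rw [this]; exact neg_mem mim
    have mreA : (fun k => ((fA k).re : ℂ)) ∈ InvSU := by
      have : (fun k => ((fA k).re : ℂ)) = fA := funext hAre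
      rw [this]; exact mA
    have mimA : (fun k => ((fA k).im : ℂ)) ∈ InvSU := by
      have : (fun k => ((fA k).im : ℂ)) = 0 := by funext k; simp [hAim]
      rw [this]; exact zero_mem _
    set c : ℂ := Complex.I * (l : ℂ) / 8 with hc
    have hpsi : ∀ k, ((psi l k : Sphere l) : Matrix (Fin 2) (Fin 2) ℂ) =
        fA k • (c • !![1, 0; 0, -1]) + fB k • (c • !![0, 0; 2, 0])
          + fC k • (c • !![0, 2; 0, 0]) := by
      intro k
      have hinv : ((k⁻¹ : SU2) : Matrix (Fin 2) (Fin 2) ℂ) = k.1.adjugate := by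
        have h1 : (k : Matrix (Fin 2) (Fin 2) ℂ) * ((k⁻¹ : SU2) : Matrix (Fin 2) (Fin 2) ℂ) = 1 := by
          rw [← Submonoid.coe_mul, mul_inv_cancel]; rfl
        have h2 := Matrix.adjugate_mul k.1
        rw [(Matrix.mem_specialUnitaryGroup_iff.1 k.2).2, one_smul] at h2
        exact (left_inv_eq_right_inv h2 h1).symm
      have hst : k.1ᴴ = k.1.adjugate := by rw [← hinv]; rfl
      rw [Matrix.adjugate_fin_two] at hst
      have e1 : star (k.1 0 0) = k.1 1 1 := by
        simpa using congrFun (congrFun hst 0) 0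
      have e2 : star (k.1 1 0) = -k.1 0 1 := by
        simpa using congrFun (congrFun hst 0) 1
      have f0 : fA k = k.1 0 0 * k.1 1 1 + k.1 1 0 * k.1 0 1 := by
        rw [← e1, ← neg_neg (k.1 0 1), ← e2]; simp [fA, coord, sub_eq_add_neg]
      have f1 : fB k = k.1 1 1 * k.1 1 0 := by rw [← e1]; simp [fB, coord]
      have f2 : fC k = -(k.1 0 0 * k.1 0 1) := by
        rw [← neg_neg (k.1 0 1), ← e2]; simp [fC, coord]
      simp only [psi, hinv, basePoint, f0, f1, f2, ← hc]
      rw [Matrix.adjugate_fin_two]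
      ext i j
      fin_cases i <;> fin_cases j <;>
        simp [Matrix.mul_apply, Fin.sum_univ_two] <;> ring
    have : pull l f = (fun k => φ (fA k • (c • !![1, 0; 0, -1])))
        + (fun k => φ (fB k • (c • !![0, 0; 2, 0]))) + fun k => φ (fC k • (c • !![0, 2; 0, 0])) := by
      funext k
      change f (psi l k) = _
      rw [hφ, hpsi]
      simp only [map_add, Pi.add_apply]
    change pull l f ∈ InvSU
    rw [this]
    exact add_mem (add_mem (hlin _ _ mreA mimA) (hlin _ _ mre mim)) (hlin _ _ mre' mim')
  exact key p.2

/-- The pull-back `Pol → InvSU`, `p ↦ p ∘ ψ`. It is an isomorphism for `l ≠ 0`. -/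
def pullPol (l : ℝ) : Pol l →ₐ[ℂ] InvSU :=
  ((pull l).comp (Pol l).val).codRestrict InvSU fun p => pull_mem_InvSU l p

/-- The seminorm `∑ a_I e ^ I ↦ ∑ (|I|!) ^ R * C ^ |I| * |a_I|` on the symmetric algebra, for
`C ≥ 1`. This is `(C ‖·‖)_R` for the 1-norm of the basis `Û, Û̄, V̂, V̂̄`. -/
def trSeminorm (R : ℝ) (C : Set.Ici (1 : ℝ)) : Seminorm ℂ PolC2 :=
  Seminorm.of
    (fun P => ∑ I ∈ P.support, ((I.degree.factorial : ℝ) ^ R * (C : ℝ) ^ I.degree) * ‖P.coeff I‖)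
    (by
      intro P Q
      classical
      have hC : (0 : ℝ) ≤ C := zero_le_one.trans C.2
      have ext : ∀ S : PolC2, S.support ⊆ P.support ∪ Q.support →
          ∑ I ∈ S.support, ((I.degree.factorial : ℝ) ^ R * (C : ℝ) ^ I.degree) * ‖S.coeff I‖ =
          ∑ I ∈ P.support ∪ Q.support,
            ((I.degree.factorial : ℝ) ^ R * (C : ℝ) ^ I.degree) * ‖S.coeff I‖ := by
        intro S hS
        apply Finset.sum_subset hS
        intro I _ hI
        rw [MvPolynomial.notMem_support_iff.1 hI]
        simp
      rw [ext _ MvPolynomial.support_add, ext P Finset.subset_union_left,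
        ext Q Finset.subset_union_right, ← Finset.sum_add_distrib]
      apply Finset.sum_le_sum
      intro I _
      rw [← mul_add, MvPolynomial.coeff_add]
      exact mul_le_mul_of_nonneg_left (norm_add_le _ _) (by positivity))
    (by
      intro c P
      rw [Finset.mul_sum]
      by_cases hc : c = 0
      · simp [hc]
      · have hs : (c • P).support = P.support := by
          ext I; simp [MvPolynomial.mem_support_iff, hc]
        rw [hs]
        apply Finset.sum_congr rfl
        intro I _
        rw [MvPolynomial.coeff_smul, norm_smul]
        ring)

/-- The `T_R`-topology on the polynomials on `ℂ²`: the locally convex topology of the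
seminorms `trSeminorm R C`, `C ≥ 1`. -/
@[reducible] def trTopology (R : ℝ) : TopologicalSpace PolC2 :=
  SeminormFamily.moduleFilterBasis (trSeminorm R) |>.topology

/-- The subspace topology on the algebra generated by `Â, B̂, Ĉ, D̂`. -/
@[reducible] def subTopology (R : ℝ) : TopologicalSpace InvC2 :=
  (trTopology R).induced Subtype.val

/-- The quotient topology on the algebra of functions on `SU(2)` generated by `A, B, C`. -/
@[reducible] def quotTopology (R : ℝ) : TopologicalSpace InvSU :=
  (subTopology R).coinduced restrictInv

/-- The reduction-`T_R`-topology, transported to polynomials on the sphere. -/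
@[reducible] def reductionTopology (l R : ℝ) : TopologicalSpace (Pol l) :=
  (quotTopology R).induced (pullPol l)

theorem isTopologicalAddGroup_sub (R : ℝ) :
    @IsTopologicalAddGroup InvC2 (subTopology R) _ := by
  let : TopologicalSpace PolC2 := trTopology R
  have : IsTopologicalAddGroup PolC2 :=
    (SeminormFamily.moduleFilterBasis (trSeminorm R)).toAddGroupFilterBasis.isTopologicalAddGroup
  exact topologicalAddGroup_induced (InvC2.val : InvC2 →ₐ[ℂ] PolC2)

theorem isTopologicalAddGroup_quot (R : ℝ) :
    @IsTopologicalAddGroup InvSU (quotTopology R) _ := by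
  let : TopologicalSpace InvC2 := subTopology R
  have : IsTopologicalAddGroup InvC2 := isTopologicalAddGroup_sub R
  let : TopologicalSpace InvSU := quotTopology R
  have hq : Topology.IsQuotientMap restrictInv :=
    ⟨⟨rfl⟩, restrictInv_surjective⟩
  have hopen : IsOpenMap restrictInv := by
    intro S hS
    rw [← hq.isOpen_preimage]
    have : restrictInv ⁻¹' (restrictInv '' S) =
        ⋃ g ∈ {g : InvC2 | restrictInv g = 0}, (fun x => g + x) ⁻¹' S := by
      ext x
      simp only [Set.mem_preimage, Set.mem_image, Set.mem_iUnion, Set.mem_ofPred_eq]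
      constructor
      · rintro ⟨y, hy, hxy⟩
        exact ⟨y - x, by rw [map_sub, hxy, sub_self], by simpa using hy⟩
      · rintro ⟨g, hg, hx⟩
        exact ⟨g + x, hx, by rw [map_add, hg, zero_add]⟩
    rw [this]
    exact isOpen_biUnion fun g _ => hS.preimage (continuous_const.add continuous_id)
  have ho : IsOpenQuotientMap restrictInv := ⟨restrictInv_surjective, hq.continuous, hopen⟩
  refine @IsTopologicalAddGroup.mk _ _ _ ⟨?_⟩ ⟨?_⟩
  · rw [(ho.prodMap ho).continuous_comp_iff.symm]
    have : (fun p : InvSU × InvSU => p.1 + p.2) ∘ Prod.map restrictInv restrictInv =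
        restrictInv ∘ fun p : InvC2 × InvC2 => p.1 + p.2 := by
      funext p; simp
    rw [this]
    exact ho.continuous.comp continuous_add
  · rw [ho.continuous_comp_iff.symm]
    have : (fun p : InvSU => -p) ∘ restrictInv = restrictInv ∘ fun p : InvC2 => -p := by
      funext p; simp
    rw [this]
    exact ho.continuous.comp continuous_neg

/-- The vector space of polynomials on the sphere, endowed with the reduction-`T_R`-topology. -/
def PolTR (l _R : ℝ) : Type := Pol l

instance (l R : ℝ) : AddCommGroup (PolTR l R) := inferInstanceAs (AddCommGroup (Pol l))

instance (l R : ℝ) : Module ℂ (PolTR l R) := inferInstanceAs (Module ℂ (Pol l))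

instance (l R : ℝ) : TopologicalSpace (PolTR l R) := reductionTopology l R

instance (l R : ℝ) : IsTopologicalAddGroup (PolTR l R) :=
  letI : TopologicalSpace InvSU := quotTopology R
  haveI : IsTopologicalAddGroup InvSU := isTopologicalAddGroup_quot R
  topologicalAddGroup_induced (pullPol l : Pol l →ₐ[ℂ] InvSU)

instance (l R : ℝ) : UniformSpace (PolTR l R) :=
  IsTopologicalAddGroup.rightUniformSpace (PolTR l R)

instance (l R : ℝ) : IsUniformAddGroup (PolTR l R) := isUniformAddGroup_of_addCommGroup

/-- A polynomial on the sphere as an element of the topological vector space `PolTR`. -/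
def PolTR.of (l R : ℝ) (p : Pol l) : PolTR l R := p

/-- The polynomial underlying an element of `PolTR`. -/
def PolTR.toPol {l R : ℝ} (p : PolTR l R) : Pol l := p

/-! ## The completion -/

/-- The completion of the polynomials on the sphere in the reduction-`T_R`-topology. -/
abbrev PolHat (l R : ℝ) : Type := UniformSpace.Completion (PolTR l R)

/-- The canonical map of the polynomials into their completion. -/
def toHat (l R : ℝ) (p : Pol l) : PolHat l R :=
  (PolTR.of l R p : UniformSpace.Completion (PolTR l R))

/-- The extension by continuity of the star product `*_ħ` to the completion. -/
def starHat (l R : ℝ) (h : ℂ) (p q : PolHat l R) : PolHat l R :=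
  ((UniformSpace.Completion.isDenseInducing_coe (α := PolTR l R)).prodMap
      (UniformSpace.Completion.isDenseInducing_coe (α := PolTR l R))).extend
    (fun pq : PolTR l R × PolTR l R => toHat l R (starProd l h pq.1.toPol pq.2.toPol)) (p, q)

/-- The extension by continuity of the evaluation `p ↦ p(x)` to the completion. -/
def evalHat (l R : ℝ) (x : Sphere l) (p : PolHat l R) : ℂ :=
  (UniformSpace.Completion.isDenseInducing_coe (α := PolTR l R)).extend
    (fun p : PolTR l R => p.toPol.1 x) p

end QuantumSphere

end

/-!
Lift `p *_ħ q` to `∑ cₙ(ħ) Yⁿ P · Xⁿ Q` on invariant polynomials `P, Q` on `ℂ²`. Locally uniformly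
in `ħ` off the poles `|cₙ(ħ)| ≤ Mⁿ / n!²`, while `Yⁿ` and `Xⁿ` cost a factor of at most `n!` each in
the `T_R`-seminorms once `C` is enlarged. Hence the products for `ħ` in a small open set are
equicontinuous. A family of biadditive maps is one biadditive map into the functions of `ħ` with the
topology of uniform convergence, so that equicontinuity passes to the completion. Finally, if the
members of an equicontinuous family depend holomorphically on `ħ` on a dense set of arguments, they
do so everywhere, by uniform limits.
-/

noncomputable section

namespace QuantumSphere

open MvPolynomial Filter UniformSpace
open scoped UniformConvergence

/-! ## Equicontinuous families -/

section Equicontinuity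

variable {ι A B G : Type*} [AddCommGroup A] [AddCommGroup B] [AddCommGroup G]
  [UniformSpace G] [IsUniformAddGroup G]

theorem equicontinuousAt_of_eventually_mem_nhds_zero {X : Type*} [TopologicalSpace X]
    {F : ι → X → G} {x₀ : X} (h₀ : ∀ i, F i x₀ = 0)
    (h : ∀ V ∈ 𝓝 (0 : G), ∀ᶠ x in 𝓝 x₀, ∀ i, F i x ∈ V) : EquicontinuousAt F x₀ := by
  intro U hU
  rw [uniformity_eq_comap_nhds_zero, mem_comap] at hU
  obtain ⟨V, hV, hVU⟩ := hU
  filter_upwards [h V hV] with x hx i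
  exact hVU (by simpa only [Set.mem_preimage, h₀ i, sub_zero] using hx i)

/-- A family of biadditive maps as one biadditive map into the functions on the index type with
the topology of uniform convergence: continuity of the latter is equicontinuity of the family. -/
def uniformFamily (φ : ι → A →+ B →+ G) : A →+ B →+ (ι →ᵤ G) :=
  .mk' (fun a => .mk' (fun b => UniformFun.ofFun fun i => φ i a b) fun b b' => by
      funext i; exact map_add (φ i a) b b') fun a a' => by
    ext b; funext i; exact DFunLike.congr_fun (map_add (φ i) a a') b

variable [TopologicalSpace A] [IsTopologicalAddGroup A]
  [TopologicalSpace B] [IsTopologicalAddGroup B]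

theorem equicontinuous_of_equicontinuousAt_zero₂ (φ : ι → A →+ B →+ G)
    (h : EquicontinuousAt (fun i (z : A × B) => φ i z.1 z.2) (0, 0))
    (hl : ∀ a, EquicontinuousAt (fun i => ⇑(φ i a)) 0)
    (hr : ∀ b, EquicontinuousAt (fun i a => φ i a b) 0) :
    Equicontinuous fun i (z : A × B) => φ i z.1 z.2 :=
  equicontinuous_iff_continuous.2 <|
    continuous_of_continuousAt_zero₂ (uniformFamily φ)
      (equicontinuousAt_iff_continuousAt.1 h)
      (fun a => equicontinuousAt_iff_continuousAt.1 (hl a))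
      (fun b => equicontinuousAt_iff_continuousAt.1 (hr b))

end Equicontinuity

theorem isDenseInducing_coe_prodMap (A B : Type*) [UniformSpace A] [UniformSpace B] :
    IsDenseInducing (Prod.map (↑) (↑) : A × B → Completion A × Completion B) :=
  Completion.isDenseInducing_coe.prodMap Completion.isDenseInducing_coe

section Completion

variable {ι A B G : Type*} [AddCommGroup A] [UniformSpace A] [IsUniformAddGroup A]
  [AddCommGroup B] [UniformSpace B] [IsUniformAddGroup B]
  [AddCommGroup G] [UniformSpace G] [IsUniformAddGroup G]

theorem equicontinuous_extend_completion [CompleteSpace G] [T2Space G] (φ : ι → A →+ B →+ G)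
    (hφ : Equicontinuous fun i (z : A × B) => φ i z.1 z.2) :
    Equicontinuous fun i =>
      (isDenseInducing_coe_prodMap A B).extend fun z => φ i z.1 z.2 := by
  have dA : IsDenseInducing (Completion.toCompl : A →+ Completion A) :=
    Completion.isDenseInducing_coe
  have dB : IsDenseInducing (Completion.toCompl : B →+ Completion B) :=
    Completion.isDenseInducing_coe
  have hΦ : Continuous fun z : A × B => uniformFamily φ z.1 z.2 :=
    equicontinuous_iff_continuous.1 hφ
  set Φ := (isDenseInducing_coe_prodMap A B).extend fun z => uniformFamily φ z.1 z.2
  have hΦc : Continuous Φ := dA.extend_Z_bilin dB hΦ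
  have hext (i : ι) : ((isDenseInducing_coe_prodMap A B).extend fun z => φ i z.1 z.2) =
      fun z => UniformFun.toFun (Φ z) i := by
    refine (isDenseInducing_coe_prodMap A B).extend_unique (fun z => ?_)
      ((UniformFun.uniformContinuous_eval G i).continuous.comp hΦc)
    exact congrFun ((isDenseInducing_coe_prodMap A B).extend_eq hΦ z) i
  simp only [hext]
  exact equicontinuous_iff_continuous.2 hΦc

end Completion

theorem differentiableOn_of_equicontinuous {X E : Type*} [TopologicalSpace X]
    [NormedAddCommGroup E] [NormedSpace ℂ E] [CompleteSpace E] {U : Set ℂ} (hU : IsOpen U)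
    {F : ℂ → X → E} (hF : Equicontinuous fun h : U => F h)
    {D : Set X} (hD : Dense D) (hFD : ∀ x ∈ D, DifferentiableOn ℂ (F · x) U) (x : X) :
    DifferentiableOn ℂ (F · x) U := by
  have : (𝓝[D] x).NeBot := mem_closure_iff_nhdsWithin_neBot.1 (hD x)
  have hlim : TendstoUniformlyOn (fun y h => F h y) (F · x) (𝓝[D] x) U := fun V hV =>
    nhdsWithin_le_nhds <| (hF x V hV).mono fun y hy h hh => hy ⟨h, hh⟩
  exact hlim.tendstoLocallyUniformlyOn.differentiableOn
    (eventually_mem_nhdsWithin.mono fun y hy => hFD y hy) hU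

/-! ## Left invariant vector fields on polynomials -/

/-- The derivation of the polynomials on `ℂ²` that extends the left invariant vector field of
`Z ∈ sl(2, ℂ)`. -/
def polyField (Z : Matrix (Fin 2) (Fin 2) ℂ) : Derivation ℂ PolC2 PolC2 :=
  mkDerivation ℂ ![Z 0 0 • X 0 - Z 1 0 • X 3, Z 0 1 • X 2 - Z 0 0 • X 1,
    Z 0 0 • X 2 + Z 1 0 • X 1, -(Z 0 0 • X 3) - Z 0 1 • X 0]

theorem polyField_add_I_smul (A B : Matrix (Fin 2) (Fin 2) ℂ) :
    polyField (A + Complex.I • B) = polyField A + Complex.I • polyField B := by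
  apply derivation_ext
  intro i
  simp only [Derivation.add_apply, Derivation.smul_apply, polyField, mkDerivation_X,
    Matrix.add_apply, Matrix.smul_apply, smul_eq_mul]
  fin_cases i <;> simp only [Fin.reduceFinMk, Fin.zero_eta, Fin.mk_one, Matrix.cons_val] <;>
    module

theorem expSU_zero : expSU 0 = 1 :=
  Subtype.ext (by simp [expSU])

theorem conjTranspose_eq_adjugate (k : SU2) : k.1ᴴ = k.1.adjugate := by
  have hstar : k.1ᴴ * k.1 = 1 :=
    Matrix.mem_unitaryGroup_iff'.1 (Matrix.mem_specialUnitaryGroup_iff.1 k.2).1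
  have hadj := Matrix.mul_adjugate k.1
  rw [(Matrix.mem_specialUnitaryGroup_iff.1 k.2).2, one_smul] at hadj
  exact left_inv_eq_right_inv hstar hadj

theorem SU2.apply_one_one (k : SU2) : k.1 1 1 = star (k.1 0 0) := by
  simpa [Matrix.adjugate_fin_two] using
    (congrFun (congrFun (conjTranspose_eq_adjugate k) 0) 0).symm

theorem SU2.apply_zero_one (k : SU2) : k.1 0 1 = -star (k.1 1 0) := by
  have h := congrFun (congrFun (conjTranspose_eq_adjugate k) 0) 1
  rw [Matrix.adjugate_fin_two, Matrix.conjTranspose_apply] at h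
  exact neg_eq_iff_eq_neg.1 h.symm

open scoped Matrix.Norms.Operator in
theorem hasDerivAt_mul_expSU (E : su2) (k : SU2) (i j : Fin 2) :
    HasDerivAt (fun t : ℝ => (k * expSU (t • E)).1 i j) ((k.1 * E.1) i j) 0 := by
  have hexp : HasDerivAt (fun t : ℝ => NormedSpace.exp (t • E.1)) E.1 0 := by
    have h := hasDerivAt_exp_smul_const (𝕂 := ℝ) E.1 (0 : ℝ)
    rwa [zero_smul, NormedSpace.exp_zero, one_mul] at h
  let L : Matrix (Fin 2) (Fin 2) ℂ →ₗ[ℝ] ℂ :=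
    Matrix.entryLinearMap ℝ ℂ i j ∘ₗ LinearMap.mulLeft ℝ k.1
  exact L.toContinuousLinearMap.hasFDerivAt.comp_hasDerivAt (0 : ℝ) hexp

theorem restrict_X (i : Fin 4) : restrict (X i) = coord i :=
  aeval_X ..

theorem hasDerivAt_coord (E : su2) (k : SU2) (i : Fin 4) :
    HasDerivAt (fun t : ℝ => coord i (k * expSU (t • E))) (restrict (polyField E.1 (X i)) k) 0 := by
  have hu := hasDerivAt_mul_expSU E k 0 0
  have hv := hasDerivAt_mul_expSU E k 1 0
  have hE00 : star (E.1 0 0) = -E.1 0 0 := congrFun (congrFun E.2.1 0) 0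
  have hE10 : star (E.1 1 0) = -E.1 0 1 := congrFun (congrFun E.2.1 0) 1
  rw [Matrix.mul_apply, Fin.sum_univ_two, k.apply_zero_one] at hu
  rw [Matrix.mul_apply, Fin.sum_univ_two, k.apply_one_one] at hv
  have hu' := hu.star
  have hv' := hv.star
  rw [star_add, star_mul', star_mul', hE00, hE10, star_neg, star_star] at hu'
  rw [star_add, star_mul', star_mul', hE00, hE10, star_star] at hv'
  rw [polyField, mkDerivation_X]
  fin_cases i <;>
    simp only [Fin.reduceFinMk, Fin.zero_eta, Fin.mk_one, Matrix.cons_val, map_add, map_sub,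
      map_neg, map_smul, Pi.add_apply, Pi.sub_apply, Pi.neg_apply, Pi.smul_apply, smul_eq_mul,
      restrict_X, coord]
  · exact hu.congr_deriv (by ring)
  · exact hu'.congr_deriv (by ring)
  · exact hv.congr_deriv (by ring)
  · exact hv'.congr_deriv (by ring)

theorem hasDerivAt_restrict (E : su2) (k : SU2) (P : PolC2) :
    HasDerivAt (fun t : ℝ => restrict P (k * expSU (t • E))) (restrict (polyField E.1 P) k) 0 := by
  induction P using MvPolynomial.induction_on with
  | C a => simpa [restrict] using hasDerivAt_const (0 : ℝ) a
  | add P Q hP hQ =>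
    simp only [map_add, Pi.add_apply]
    exact hP.add hQ
  | mul_X P i hP =>
    have h := hP.mul (hasDerivAt_coord E k i)
    rw [zero_smul, expSU_zero, mul_one] at h
    simp only [map_mul, restrict_X, Pi.mul_apply]
    refine h.congr_deriv ?_
    simp only [Derivation.leibniz, smul_eq_mul, map_add, map_mul, Pi.add_apply, Pi.mul_apply,
      restrict_X]
    ring

theorem leftFieldC_restrict (Z : Matrix (Fin 2) (Fin 2) ℂ) (hZ : Z.trace = 0) (P : PolC2) :
    leftFieldC Z hZ (restrict P) = restrict (polyField Z P) := by
  funext k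
  conv_rhs => rw [← partE_add_I_smul_partF Z hZ, polyField_add_I_smul]
  simp only [leftFieldC, leftField, (hasDerivAt_restrict _ k P).deriv, Derivation.add_apply,
    Derivation.smul_apply, map_add, map_smul, Pi.add_apply, Pi.smul_apply, smul_eq_mul]

/-- The linear vector field `z i ↦ c i • z i.rev` on `ℂ²`. The reversal of `Fin 4` exchanges `Û`
with `V̂̄` and `Û̄` with `V̂`, so that the fields of `X` and `Y` are of this form. -/
def linearField (c : Fin 4 → ℂ) : Derivation ℂ PolC2 PolC2 :=
  ∑ i, (c i • X i.rev : PolC2) • pderiv i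

/-- The polynomial extension of the vector field `leftX`. -/
def polyX : Module.End ℂ PolC2 := (linearField ![0, 1, 0, -1]).toLinearMap

/-- The polynomial extension of the vector field `leftY`. -/
def polyY : Module.End ℂ PolC2 := (linearField ![-1, 0, 1, 0]).toLinearMap

theorem linearField_apply (c : Fin 4 → ℂ) (P : PolC2) :
    linearField c P = ∑ i, c i • (X i.rev * pderiv i P) := by
  simp [linearField, Fin.sum_univ_four]

theorem polyField_X : (polyField !![0, 1; 0, 0]).toLinearMap = polyX :=
  congrArg _ <| derivation_ext fun i => by
    fin_cases i <;>
      simp [polyField, mkDerivation_X, linearField_apply, pderiv_X, Pi.single_apply]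

theorem polyField_Y : (polyField !![0, 0; 1, 0]).toLinearMap = polyY :=
  congrArg _ <| derivation_ext fun i => by
    fin_cases i <;>
      simp [polyField, mkDerivation_X, linearField_apply, pderiv_X, Pi.single_apply]

theorem leftX_iterate_restrict (n : ℕ) (P : PolC2) :
    leftX^[n] (restrict P) = restrict ((polyX ^ n) P) := by
  rw [Module.End.pow_apply, ← polyField_X]
  have h : Function.Semiconj restrict (polyField !![0, 1; 0, 0]) leftX :=
    fun P => (leftFieldC_restrict _ _ P).symm
  exact (h.iterate_right n P).symm

theorem leftY_iterate_restrict (n : ℕ) (P : PolC2) :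
    leftY^[n] (restrict P) = restrict ((polyY ^ n) P) := by
  rw [Module.End.pow_apply, ← polyField_Y]
  have h : Function.Semiconj restrict (polyField !![0, 0; 1, 0]) leftY :=
    fun P => (leftFieldC_restrict _ _ P).symm
  exact (h.iterate_right n P).symm

/-! ## Weights -/

theorem isWeightedHomogeneous_linearField_pow {M : Type*} [AddCommGroup M] {w : Fin 4 → M}
    {c : Fin 4 → ℂ} {a m : M} (hc : ∀ i, c i ≠ 0 → w i.rev = w i + a) {P : PolC2}
    (hP : P.IsWeightedHomogeneous w m) (n : ℕ) :
    IsWeightedHomogeneous w (((linearField c).toLinearMap ^ n) P) (m + n • a) := by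
  induction n with
  | zero => simpa using hP
  | succ n ih =>
    rw [pow_succ', Module.End.mul_apply, Derivation.coeFn_coe, linearField_apply]
    refine IsWeightedHomogeneous.sum _ _ _ fun i _ => ?_
    by_cases hi : c i = 0
    · simpa only [hi, zero_smul] using isWeightedHomogeneous_zero ..
    · have h := (isWeightedHomogeneous_X ℂ w i.rev).mul (ih.pderiv (sub_add_cancel _ (w i)))
      rw [hc i hi] at h
      have hw : w i + a + (m + n • a - w i) = m + (n + 1) • a := by rw [succ_nsmul]; abel
      exact (weightedHomogeneousSubmodule ℂ w _).smul_mem (c i) (hw ▸ h)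

/-- The weights of the circle action on `ℂ²`. -/
def circleWeight : Fin 4 → ℤ := ![1, -1, 1, -1]

theorem isWeightedHomogeneous_polyX_pow {P : PolC2} {m : ℤ}
    (hP : P.IsWeightedHomogeneous circleWeight m) (n : ℕ) :
    IsWeightedHomogeneous circleWeight ((polyX ^ n) P) (m + n • 2) :=
  isWeightedHomogeneous_linearField_pow (fun i => by fin_cases i <;> simp [circleWeight]) hP n

theorem isWeightedHomogeneous_polyY_pow {P : PolC2} {m : ℤ}
    (hP : P.IsWeightedHomogeneous circleWeight m) (n : ℕ) :
    IsWeightedHomogeneous circleWeight ((polyY ^ n) P) (m + n • (-2)) :=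
  isWeightedHomogeneous_linearField_pow (fun i => by fin_cases i <;> simp [circleWeight]) hP n

theorem polyY_pow_monomial_eq_zero {I : Fin 4 →₀ ℕ} {n : ℕ} (hn : I.degree < n) (a : ℂ) :
    (polyY ^ n) (monomial I a) = 0 := by
  -- `polyY` lowers the degree in `Û` and `V̂`, which cannot become negative.
  let w : Fin 4 → ℤ := ![1, 0, 1, 0]
  have hw (J : Fin 4 →₀ ℕ) : Finsupp.weight w J = J 0 + J 2 := by
    rw [Finsupp.weight_apply, Finsupp.sum_fintype _ _ (by simp)]
    simp [w, Fin.sum_univ_four]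
  have h := isWeightedHomogeneous_linearField_pow (c := ![-1, 0, 1, 0]) (a := -1)
    (fun i => by fin_cases i <;> simp [w]) (isWeightedHomogeneous_monomial w I a rfl) n
  ext J
  by_contra hJ
  have hJI := h hJ
  rw [hw, hw, nsmul_eq_mul] at hJI
  rw [Finsupp.degree_eq_sum, Fin.sum_univ_four] at hn
  omega

theorem polyY_pow_eq_zero {P : PolC2} {n : ℕ} (hn : P.totalDegree < n) : (polyY ^ n) P = 0 := by
  rw [P.as_sum, map_sum]
  exact Finset.sum_eq_zero fun I hI =>
    polyY_pow_monomial_eq_zero ((le_totalDegree hI).trans_lt hn) _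

theorem X_mul_X_mem_InvC2 {i j : Fin 4} (hi : i = 0 ∨ i = 2) (hj : j = 1 ∨ j = 3) :
    (X i * X j : PolC2) ∈ InvC2 := by
  have mA : hA ∈ InvC2 := Algebra.subset_adjoin (by simp)
  have mB : hB ∈ InvC2 := Algebra.subset_adjoin (by simp)
  have mC : hC ∈ InvC2 := Algebra.subset_adjoin (by simp)
  have mD : hD ∈ InvC2 := Algebra.subset_adjoin (by simp)
  rcases hi with rfl | rfl <;> rcases hj with rfl | rfl
  · have h : (X 0 * X 1 : PolC2) = (1 / 2 : ℂ) • (hD + hA) := by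
      rw [hA, hD, add_add_sub_cancel, ← two_smul ℂ, smul_smul]
      norm_num
    exact h ▸ InvC2.smul_mem (add_mem mD mA) _
  · exact mC
  · exact mul_comm (X 1 : PolC2) (X 2) ▸ mB
  · have h : (X 2 * X 3 : PolC2) = (1 / 2 : ℂ) • (hD - hA) := by
      rw [hA, hD, add_sub_sub_cancel, ← two_smul ℂ, smul_smul]
      norm_num
    exact h ▸ InvC2.smul_mem (sub_mem mD mA) _

theorem monomial_mem_InvC2 {I : Fin 4 →₀ ℕ} (hI : I 0 + I 2 = I 1 + I 3) :
    (monomial I 1 : PolC2) ∈ InvC2 := by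
  have hmem {i j : Fin 4} (hi : i = 0 ∨ i = 2) (hj : j = 1 ∨ j = 3) (n : ℕ) :
      (X i * X j : PolC2) ^ n ∈ InvC2 := pow_mem (X_mul_X_mem_InvC2 hi hj) n
  have hmonomial : (monomial I 1 : PolC2) = X 0 ^ I 0 * X 1 ^ I 1 * X 2 ^ I 2 * X 3 ^ I 3 := by
    rw [monomial_eq, C_1, one_mul, Finsupp.prod_fintype _ _ (by simp), Fin.prod_univ_four]
  rw [hmonomial]
  obtain h | h := le_total (I 0) (I 1)
  · obtain ⟨a, ha⟩ := Nat.exists_eq_add_of_le h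
    rw [ha, show I 2 = a + I 3 by omega]
    have := mul_mem (mul_mem (hmem (.inl rfl) (.inl rfl) (I 0)) (hmem (.inr rfl) (.inl rfl) a))
      (hmem (.inr rfl) (.inr rfl) (I 3))
    convert this using 1
    ring
  · obtain ⟨a, ha⟩ := Nat.exists_eq_add_of_le h
    rw [ha, show I 3 = a + I 2 by omega]
    have := mul_mem (mul_mem (hmem (.inl rfl) (.inl rfl) (I 1)) (hmem (.inl rfl) (.inr rfl) a))
      (hmem (.inr rfl) (.inr rfl) (I 2))
    convert this using 1
    ring

theorem isWeightedHomogeneous_of_mem_InvC2 {P : PolC2} (hP : P ∈ InvC2) :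
    P.IsWeightedHomogeneous circleWeight 0 := by
  have hX (i j : Fin 4) (h : circleWeight i + circleWeight j = 0) :
      (X i * X j : PolC2).IsWeightedHomogeneous circleWeight 0 :=
    h ▸ (isWeightedHomogeneous_X _ _ i).mul (isWeightedHomogeneous_X _ _ j)
  refine Algebra.adjoin_induction (p := fun P _ => P.IsWeightedHomogeneous circleWeight 0)
    ?_ ?_ ?_ ?_ hP
  · rintro P (rfl | rfl | rfl | rfl)
    · exact (hX _ _ (by simp [circleWeight])).sub (hX _ _ (by simp [circleWeight]))
    · exact hX _ _ (by simp [circleWeight])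
    · exact hX _ _ (by simp [circleWeight])
    · exact (hX _ _ (by simp [circleWeight])).add (hX _ _ (by simp [circleWeight]))
  · exact fun c => isWeightedHomogeneous_C _ c
  · exact fun P Q _ _ hP hQ => hP.add hQ
  · exact fun P Q _ _ hP hQ => by simpa only [add_zero] using hP.mul hQ

theorem mem_InvC2_iff_isWeightedHomogeneous {P : PolC2} :
    P ∈ InvC2 ↔ P.IsWeightedHomogeneous circleWeight 0 := by
  refine ⟨isWeightedHomogeneous_of_mem_InvC2, fun hP => ?_⟩
  have hweight (I : Fin 4 →₀ ℕ) :
      Finsupp.weight circleWeight I = (I 0 + I 2 : ℤ) - (I 1 + I 3) := by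
    rw [Finsupp.weight_apply, Finsupp.sum_fintype _ _ (by simp)]
    simp only [circleWeight, nsmul_eq_mul, Fin.sum_univ_four, Matrix.cons_val]
    ring
  rw [P.as_sum]
  refine sum_mem fun I hI => ?_
  have hI0 := hP (mem_support_iff.1 hI)
  rw [hweight] at hI0
  rw [← mul_one (P.coeff I), ← smul_eq_mul, ← smul_monomial]
  exact InvC2.smul_mem (monomial_mem_InvC2 (by omega)) _

theorem pow_polyY_mul_pow_polyX_mem_InvC2 {P Q : PolC2} (hP : P ∈ InvC2) (hQ : Q ∈ InvC2) (n : ℕ) :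
    (polyY ^ n) P * (polyX ^ n) Q ∈ InvC2 := by
  rw [mem_InvC2_iff_isWeightedHomogeneous] at *
  have h := (isWeightedHomogeneous_polyY_pow hP n).mul (isWeightedHomogeneous_polyX_pow hQ n)
  rwa [zero_add, zero_add, ← nsmul_add, neg_add_cancel, nsmul_zero] at h

/-! ## The bidifferential operators `∑ n, c n • Y ^ n ⊗ X ^ n` -/

theorem support_smul_polyY_pow_mul_subset (c : ℕ → ℂ) (P Q : PolC2) {N : ℕ}
    (hN : P.totalDegree < N) :
    (Function.support fun n => c n • ((polyY ^ n) P * (polyX ^ n) Q)) ⊆ Finset.range N := by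
  intro n hn
  rw [Finset.coe_range, Set.mem_Iio]
  by_contra! h
  exact hn (by simp only [polyY_pow_eq_zero (hN.trans_le h), zero_mul, smul_zero])

/-- The lift `(P, Q) ↦ ∑ n, c n • Y ^ n P * X ^ n Q` of a bidifferential operator on `SU(2)` to
polynomials on `ℂ²`; the star product `*_ħ` corresponds to `c = starCoeff l ħ`. -/
def polyStar (c : ℕ → ℂ) : PolC2 →ₗ[ℂ] PolC2 →ₗ[ℂ] PolC2 :=
  have hfin (P Q : PolC2) :
      (Function.support fun n => c n • ((polyY ^ n) P * (polyX ^ n) Q)).Finite :=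
    (Finset.finite_toSet _).subset
      (support_smul_polyY_pow_mul_subset c P Q (Nat.lt_succ_self _))
  LinearMap.mk₂ ℂ (fun P Q => ∑ᶠ n, c n • ((polyY ^ n) P * (polyX ^ n) Q))
    (fun P P' Q => by
      rw [← finsum_add_distrib (hfin _ _) (hfin _ _)]
      simp only [map_add, add_mul, smul_add])
    (fun a P Q => by
      rw [smul_finsum]
      simp only [map_smul, smul_mul_assoc, smul_comm a])
    (fun P Q Q' => by
      rw [← finsum_add_distrib (hfin _ _) (hfin _ _)]
      simp only [map_add, mul_add, smul_add])
    (fun a P Q => by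
      rw [smul_finsum]
      simp only [map_smul, mul_smul_comm, smul_comm a])

theorem polyStar_eq_sum (c : ℕ → ℂ) (P Q : PolC2) {N : ℕ} (hN : P.totalDegree < N) :
    polyStar c P Q = ∑ n ∈ Finset.range N, c n • ((polyY ^ n) P * (polyX ^ n) Q) :=
  finsum_eq_sum_of_support_subset _ (support_smul_polyY_pow_mul_subset c P Q hN)

theorem polyStar_mem_InvC2 (c : ℕ → ℂ) {P Q : PolC2} (hP : P ∈ InvC2) (hQ : Q ∈ InvC2) :
    polyStar c P Q ∈ InvC2 := by
  rw [polyStar_eq_sum c P Q (Nat.lt_succ_self _)]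
  exact sum_mem fun n _ => InvC2.smul_mem (pow_polyY_mul_pow_polyX_mem_InvC2 hP hQ n) _

/-! ## Estimates for the `T_R`-seminorms -/

section Estimates

variable {R : ℝ} {C C' : Set.Ici (1 : ℝ)}

theorem Ici_one_nonneg (C : Set.Ici (1 : ℝ)) : (0 : ℝ) ≤ C :=
  zero_le_one.trans C.2

theorem trSeminorm_monomial (R : ℝ) (C : Set.Ici (1 : ℝ)) (I : Fin 4 →₀ ℕ) (a : ℂ) :
    trSeminorm R C (monomial I a) =
      ((I.degree.factorial : ℝ) ^ R * (C : ℝ) ^ I.degree) * ‖a‖ := by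
  classical
  change ∑ J ∈ _, _ = _
  by_cases ha : a = 0
  · simp [ha]
  · simp [support_monomial, ha]

theorem seminorm_le_trSeminorm {E : Type*} [AddCommGroup E] [Module ℂ E] (q : Seminorm ℂ E)
    (F : PolC2 →ₗ[ℂ] E) (R : ℝ) (C : Set.Ici (1 : ℝ)) (K : ℝ)
    (hF : ∀ I, q (F (monomial I 1)) ≤ K * trSeminorm R C (monomial I 1)) (P : PolC2) :
    q (F P) ≤ K * trSeminorm R C P := by
  have hterm (I : Fin 4 →₀ ℕ) : q (F (monomial I (P.coeff I))) ≤
      K * (((I.degree.factorial : ℝ) ^ R * (C : ℝ) ^ I.degree) * ‖P.coeff I‖) := by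
    have h := mul_le_mul_of_nonneg_left (hF I) (norm_nonneg (P.coeff I))
    rw [trSeminorm_monomial, norm_one, mul_one, ← map_smul_eq_mul, ← map_smul, smul_monomial,
      smul_eq_mul, mul_one] at h
    linarith
  calc q (F P) = q (∑ I ∈ P.support, F (monomial I (P.coeff I))) := by
        rw [← map_sum, ← P.as_sum]
    _ ≤ ∑ I ∈ P.support, q (F (monomial I (P.coeff I))) :=
        Finset.le_sum_of_subadditive q (map_zero q).le (map_add_le_add q) _ _
    _ ≤ K * trSeminorm R C P := (Finset.sum_le_sum fun I _ => hterm I).trans_eq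
        (Finset.mul_sum _ _ K).symm

theorem trSeminorm_mono (R : ℝ) : Monotone (trSeminorm R) := fun C C' h P => by
  have hC := Ici_one_nonneg C
  refine Finset.sum_le_sum fun I _ => ?_
  gcongr

theorem factorial_add_le (m n : ℕ) :
    ((m + n).factorial : ℝ) ≤ 2 ^ (m + n) * (m.factorial * n.factorial) := by
  rw [← Nat.add_choose_mul_factorial_mul_factorial m n]
  push_cast
  rw [mul_assoc]
  gcongr
  exact_mod_cast Nat.choose_le_two_pow _ _

theorem factorial_add_rpow_mul_pow_le (hR : 0 ≤ R) (h : 2 ^ R * C ≤ (C' : ℝ)) (m n : ℕ) :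
    ((m + n).factorial : ℝ) ^ R * (C : ℝ) ^ (m + n) ≤
      ((m.factorial : ℝ) ^ R * (C' : ℝ) ^ m) * ((n.factorial : ℝ) ^ R * (C' : ℝ) ^ n) := by
  have hC := Ici_one_nonneg C
  calc ((m + n).factorial : ℝ) ^ R * (C : ℝ) ^ (m + n)
      ≤ (2 ^ (m + n) * (m.factorial * n.factorial) : ℝ) ^ R * (C : ℝ) ^ (m + n) := by
        gcongr
        exact factorial_add_le m n
    _ = ((m.factorial : ℝ) ^ R * (n.factorial : ℝ) ^ R) * (2 ^ R * C) ^ (m + n) := by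
        rw [Real.mul_rpow (by positivity) (by positivity),
          Real.mul_rpow (by positivity) (by positivity), ← Real.rpow_natCast_mul zero_le_two,
          mul_comm (((m + n : ℕ)) : ℝ), Real.rpow_mul_natCast zero_le_two, mul_pow]
        ring
    _ ≤ ((m.factorial : ℝ) ^ R * (n.factorial : ℝ) ^ R) * (C' : ℝ) ^ (m + n) := by gcongr
    _ = _ := by ring

theorem trSeminorm_mul_le (hR : 0 ≤ R) (h : 2 ^ R * C ≤ (C' : ℝ)) (P Q : PolC2) :
    trSeminorm R C (P * Q) ≤ trSeminorm R C' P * trSeminorm R C' Q := by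
  rw [mul_comm (trSeminorm R C' P)]
  refine seminorm_le_trSeminorm (trSeminorm R C) (LinearMap.mulRight ℂ Q) R C' _ (fun I => ?_) P
  rw [mul_comm (trSeminorm R C' Q)]
  refine seminorm_le_trSeminorm (trSeminorm R C) (LinearMap.mulLeft ℂ (monomial I 1)) R C' _
    (fun J => ?_) Q
  simp only [LinearMap.mulLeft_apply, monomial_mul, trSeminorm_monomial, mul_one, norm_one,
    map_add]
  exact factorial_add_rpow_mul_pow_le hR h _ _

theorem linearField_monomial (c : Fin 4 → ℂ) (I : Fin 4 →₀ ℕ) :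
    linearField c (monomial I 1) =
      ∑ i, (I i * c i) • monomial (I - .single i 1 + .single i.rev 1) 1 := by
  simp only [linearField_apply, pderiv_monomial, one_mul, X, monomial_mul, smul_monomial,
    smul_eq_mul, mul_comm, add_comm]

theorem trSeminorm_linearField_pow_monomial_le {c : Fin 4 → ℂ} (hc : ∀ i, ‖c i‖ ≤ 1) (n : ℕ)
    (I : Fin 4 →₀ ℕ) :
    trSeminorm R C (((linearField c).toLinearMap ^ n) (monomial I 1)) ≤
      (I.degree : ℝ) ^ n * trSeminorm R C (monomial I 1) := by
  induction n generalizing I with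
  | zero => simp
  | succ n ih =>
    have hterm (i : Fin 4) : trSeminorm R C (((linearField c).toLinearMap ^ n)
        ((I i * c i) • monomial (I - .single i 1 + .single i.rev 1) 1)) ≤
        I i * ((I.degree : ℝ) ^ n * trSeminorm R C (monomial I 1)) := by
      rw [map_smul, map_smul_eq_mul, norm_mul, Complex.norm_natCast]
      obtain hi | hi := eq_or_ne (I i) 0
      · simp [hi]
      have hdeg : (I - .single i 1 + .single i.rev 1).degree = I.degree := by
        conv_rhs => rw [← tsub_add_cancel_of_le
          (Finsupp.single_le_iff.2 (Nat.one_le_iff_ne_zero.2 hi) : Finsupp.single i 1 ≤ I)]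
        simp only [map_add, Finsupp.degree_single]
      have h := ih (I - .single i 1 + .single i.rev 1)
      simp only [trSeminorm_monomial, hdeg] at h ⊢
      exact mul_le_mul (mul_le_of_le_one_right (Nat.cast_nonneg _) (hc i)) h
        (apply_nonneg _ _) (Nat.cast_nonneg _)
    rw [pow_succ, Module.End.mul_apply, Derivation.coeFn_coe, linearField_monomial, map_sum]
    calc _ ≤ ∑ i, I i * ((I.degree : ℝ) ^ n * trSeminorm R C (monomial I 1)) :=
          (Finset.le_sum_of_subadditive _ (map_zero _).le (map_add_le_add _) _ _).trans
            (Finset.sum_le_sum fun i _ => hterm i)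
      _ = (I.degree : ℝ) ^ (n + 1) * trSeminorm R C (monomial I 1) := by
          rw [← Finset.sum_mul, ← Nat.cast_sum, ← Finsupp.degree_eq_sum]
          ring

theorem pow_mul_trSeminorm_linearField_pow_le {c : Fin 4 → ℂ} (hc : ∀ i, ‖c i‖ ≤ 1) {t : ℝ}
    (ht : 0 ≤ t) (h : Real.exp t * C ≤ (C' : ℝ)) (n : ℕ) (P : PolC2) :
    t ^ n * trSeminorm R C (((linearField c).toLinearMap ^ n) P) ≤
      n.factorial * trSeminorm R C' P := by
  have hC := Ici_one_nonneg C
  have hscale (Q : PolC2) : trSeminorm R C (((t : ℂ) ^ n • (linearField c).toLinearMap ^ n) Q) =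
      t ^ n * trSeminorm R C (((linearField c).toLinearMap ^ n) Q) := by
    rw [LinearMap.smul_apply, map_smul_eq_mul, norm_pow, Complex.norm_real,
      Real.norm_of_nonneg ht]
  rw [← hscale]
  refine seminorm_le_trSeminorm _ _ _ _ _ (fun I => ?_) P
  rw [hscale]
  have hexp : (t * I.degree) ^ n ≤ n.factorial * Real.exp t ^ I.degree := by
    have h := Real.pow_div_factorial_le_exp (t * I.degree) (by positivity) n
    rwa [div_le_iff₀' (by positivity), mul_comm t, Real.exp_nat_mul, mul_comm (I.degree : ℝ)] at h
  calc t ^ n * trSeminorm R C (((linearField c).toLinearMap ^ n) (monomial I 1))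
      ≤ t ^ n * ((I.degree : ℝ) ^ n * trSeminorm R C (monomial I 1)) := by
        gcongr
        exact trSeminorm_linearField_pow_monomial_le hc n I
    _ = (t * I.degree) ^ n * ((I.degree.factorial : ℝ) ^ R * (C : ℝ) ^ I.degree) := by
        rw [trSeminorm_monomial, norm_one]
        ring
    _ ≤ (n.factorial * Real.exp t ^ I.degree) *
          ((I.degree.factorial : ℝ) ^ R * (C : ℝ) ^ I.degree) := by gcongr
    _ = n.factorial * ((I.degree.factorial : ℝ) ^ R * (Real.exp t * C) ^ I.degree) := by ring
    _ ≤ n.factorial * trSeminorm R C' (monomial I 1) := by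
        rw [trSeminorm_monomial, norm_one, mul_one]
        gcongr

theorem trSeminorm_smul_polyY_pow_mul_le (hR : 0 ≤ R) {M : ℝ} (hM : 0 ≤ M)
    (h : Real.exp (M + 2) * (2 ^ R * C) ≤ (C' : ℝ)) {n : ℕ} {a : ℂ}
    (ha : ‖a‖ ≤ M ^ n / (n.factorial : ℝ) ^ 2) (P Q : PolC2) :
    trSeminorm R C (a • ((polyY ^ n) P * (polyX ^ n) Q)) ≤
      (1 / 2) ^ n * (trSeminorm R C' P * trSeminorm R C' Q) := by
  have hC₁ : 1 ≤ 2 ^ R * (C : ℝ) :=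
    one_le_mul_of_one_le_of_one_le (Real.one_le_rpow one_le_two hR) C.2
  let C₁ : Set.Ici (1 : ℝ) := ⟨2 ^ R * C, hC₁⟩
  have hexp {t : ℝ} (ht : t ≤ M + 2) : Real.exp t * C₁ ≤ (C' : ℝ) :=
    (mul_le_mul_of_nonneg_right (Real.exp_le_exp.2 ht) (Ici_one_nonneg C₁)).trans h
  have hY : M ^ n * trSeminorm R C₁ ((polyY ^ n) P) ≤ n.factorial * trSeminorm R C' P :=
    pow_mul_trSeminorm_linearField_pow_le (fun i => by fin_cases i <;> simp) hM
      (hexp (by linarith)) n P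
  have hX : 2 ^ n * trSeminorm R C₁ ((polyX ^ n) Q) ≤ n.factorial * trSeminorm R C' Q :=
    pow_mul_trSeminorm_linearField_pow_le (fun i => by fin_cases i <;> simp) zero_le_two
      (hexp (by linarith)) n Q
  calc trSeminorm R C (a • ((polyY ^ n) P * (polyX ^ n) Q))
      ≤ M ^ n / (n.factorial : ℝ) ^ 2 *
          (trSeminorm R C₁ ((polyY ^ n) P) * trSeminorm R C₁ ((polyX ^ n) Q)) := by
        rw [map_smul_eq_mul]
        gcongr
        exact trSeminorm_mul_le hR le_rfl _ _
    _ = (1 / 2) ^ n / (n.factorial : ℝ) ^ 2 * ((M ^ n * trSeminorm R C₁ ((polyY ^ n) P)) *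
          (2 ^ n * trSeminorm R C₁ ((polyX ^ n) Q))) := by
        rw [one_div, inv_pow]
        field_simp
    _ ≤ (1 / 2) ^ n / (n.factorial : ℝ) ^ 2 *
          ((n.factorial * trSeminorm R C' P) * (n.factorial * trSeminorm R C' Q)) := by gcongr
    _ = (1 / 2) ^ n * (trSeminorm R C' P * trSeminorm R C' Q) := by field_simp

theorem exists_trSeminorm_polyStar_le (hR : 0 ≤ R) {M : ℝ} (hM : 0 ≤ M) (C : Set.Ici (1 : ℝ)) :
    ∃ C' : Set.Ici (1 : ℝ), ∀ c : ℕ → ℂ, (∀ n, ‖c n‖ ≤ M ^ n / (n.factorial : ℝ) ^ 2) →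
      ∀ P Q, trSeminorm R C (polyStar c P Q) ≤ 2 * (trSeminorm R C' P * trSeminorm R C' Q) := by
  have hC' : 1 ≤ Real.exp (M + 2) * (2 ^ R * C) :=
    one_le_mul_of_one_le_of_one_le (Real.one_le_exp (by positivity))
      (one_le_mul_of_one_le_of_one_le (Real.one_le_rpow one_le_two hR) C.2)
  refine ⟨⟨_, hC'⟩, fun c hc P Q => ?_⟩
  rw [polyStar_eq_sum c P Q (Nat.lt_succ_self _)]
  calc _ ≤ ∑ n ∈ Finset.range (P.totalDegree + 1),
          trSeminorm R C (c n • ((polyY ^ n) P * (polyX ^ n) Q)) :=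
        Finset.le_sum_of_subadditive _ (map_zero _).le (map_add_le_add _) _ _
    _ ≤ ∑ n ∈ Finset.range (P.totalDegree + 1), (1 / 2 : ℝ) ^ n *
          (trSeminorm R ⟨_, hC'⟩ P * trSeminorm R ⟨_, hC'⟩ Q) :=
        Finset.sum_le_sum fun n _ => trSeminorm_smul_polyY_pow_mul_le hR hM le_rfl (hc n) P Q
    _ ≤ 2 * (trSeminorm R ⟨_, hC'⟩ P * trSeminorm R ⟨_, hC'⟩ Q) := by
        rw [← Finset.sum_mul]
        gcongr
        exact sum_geometric_two_le _

theorem norm_coord_le (i : Fin 4) (k : SU2) : ‖coord i k‖ ≤ 1 := by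
  have h := entry_norm_bound_of_unitary (Matrix.mem_specialUnitaryGroup_iff.1 k.2).1
  fin_cases i
  · exact h 0 0
  · exact (norm_star _).trans_le (h 0 0)
  · exact h 1 0
  · exact (norm_star _).trans_le (h 1 0)

theorem norm_restrict_le (hR : 0 ≤ R) (k : SU2) (P : PolC2) :
    ‖restrict P k‖ ≤ trSeminorm R ⟨1, Set.self_mem_Ici⟩ P := by
  let evalAt : PolC2 →ₗ[ℂ] ℂ := LinearMap.proj k ∘ₗ restrict.toLinearMap
  refine (seminorm_le_trSeminorm (normSeminorm ℂ ℂ) evalAt R _ 1 (fun I => ?_) P).trans_eq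
    (one_mul _)
  have hmonomial : ‖restrict (monomial I 1) k‖ ≤ 1 := by
    rw [restrict, aeval_monomial, map_one, one_mul, Finsupp.prod, Finset.prod_apply, norm_prod]
    refine Finset.prod_le_one (fun i _ => norm_nonneg _) fun i _ => ?_
    rw [Pi.pow_apply, norm_pow]
    exact pow_le_one₀ (norm_nonneg _) (norm_coord_le i k)
  have hfactorial : (1 : ℝ) ≤ (I.degree.factorial : ℝ) ^ R :=
    Real.one_le_rpow (by exact_mod_cast I.degree.factorial_pos) hR
  simpa [evalAt, trSeminorm_monomial] using hmonomial.trans hfactorial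

end Estimates

/-! ## The coefficients of the star product -/

section Coefficients

variable {l : ℝ} {h : ℂ}

theorem isClosed_poleSet (l : ℝ) : IsClosed (poleSet l) := by
  have hrange : poleSet l = insert 0 (Set.range fun n : ℕ => (l : ℂ) / ((n + 1 : ℕ) : ℂ)) := by
    ext z
    simp only [poleSet, Set.singleton_union, Set.mem_insert_iff, Set.mem_ofPred_eq, Set.mem_range]
    refine or_congr_right ⟨?_, ?_⟩
    · rintro ⟨n, hn, rfl⟩
      exact ⟨n - 1, by rw [Nat.sub_add_cancel hn]⟩
    · rintro ⟨n, rfl⟩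
      exact ⟨n + 1, n.succ_pos, rfl⟩
  rw [hrange]
  exact ((tendsto_const_div_atTop_nhds_zero_nat (𝕜 := ℂ) _).comp
    (tendsto_add_atTop_nat 1)).isCompact_insert_range.isClosed

/-- A positive lower bound for `‖l - j ħ‖ / (j + 1)`, uniform in `j` and continuous in `ħ`, as long
as `l ≠ 0` and `ħ` is not a pole. -/
def poleGap (l : ℝ) (h : ℂ) : ℝ := min |l| (Metric.infDist h (poleSet l) / 2)

theorem poleGap_pos (hl : l ≠ 0) (hh : h ∉ poleSet l) : 0 < poleGap l h :=
  lt_min (abs_pos.2 hl) <| half_pos <|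
    ((isClosed_poleSet l).notMem_iff_infDist_pos ⟨0, Or.inl rfl⟩).1 hh

theorem poleGap_mul_le (l : ℝ) (h : ℂ) (j : ℕ) : poleGap l h * (j + 1) ≤ ‖(l : ℂ) - j * h‖ := by
  obtain rfl | hj := Nat.eq_zero_or_pos j
  · simp [poleGap]
  have hj' : (1 : ℝ) ≤ j := by exact_mod_cast hj
  have hdist : Metric.infDist h (poleSet l) ≤ ‖h - l / j‖ := by
    rw [← dist_eq_norm]
    exact Metric.infDist_le_dist_of_mem (Or.inr ⟨j, hj, rfl⟩)
  have hnonneg : 0 ≤ Metric.infDist h (poleSet l) := Metric.infDist_nonneg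
  calc poleGap l h * (j + 1) ≤ Metric.infDist h (poleSet l) / 2 * (j + 1) := by
        gcongr
        exact min_le_right _ _
    _ ≤ j * Metric.infDist h (poleSet l) := by nlinarith
    _ ≤ j * ‖h - l / j‖ := by gcongr
    _ = ‖(l : ℂ) - j * h‖ := by
        rw [← Complex.norm_natCast j, ← norm_mul, norm_sub_rev, mul_sub,
          mul_div_cancel₀ _ (Nat.cast_ne_zero.2 hj.ne')]

theorem continuous_poleGap (l : ℝ) : Continuous (poleGap l) :=
  continuous_const.min ((Metric.continuous_infDist_pt _).div_const _)

theorem norm_starCoeff_le (hl : l ≠ 0) (hh : h ∉ poleSet l) (n : ℕ) :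
    ‖starCoeff l h n‖ ≤ (‖h‖ / poleGap l h) ^ n / (n.factorial : ℝ) ^ 2 := by
  have hgap := poleGap_pos hl hh
  have hprod : poleGap l h ^ n * n.factorial ≤ ‖∏ j ∈ Finset.range n, ((l : ℂ) - j * h)‖ := by
    calc poleGap l h ^ n * n.factorial = ∏ j ∈ Finset.range n, poleGap l h * (j + 1) := by
          rw [Finset.prod_mul_distrib, Finset.prod_const, Finset.card_range,
            ← Finset.prod_range_add_one_eq_factorial]
          push_cast
          rfl
      _ ≤ ‖∏ j ∈ Finset.range n, ((l : ℂ) - j * h)‖ := by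
          rw [norm_prod]
          gcongr with j
          exact poleGap_mul_le l h j
  calc ‖starCoeff l h n‖
      = ‖h‖ ^ n / (n.factorial * ‖∏ j ∈ Finset.range n, ((l : ℂ) - j * h)‖) := by
        simp only [starCoeff, norm_div, norm_mul, norm_pow, norm_neg, norm_one, one_pow, one_mul,
          Complex.norm_natCast]
    _ ≤ ‖h‖ ^ n / (n.factorial * (poleGap l h ^ n * n.factorial)) := by gcongr
    _ = (‖h‖ / poleGap l h) ^ n / (n.factorial : ℝ) ^ 2 := by
        rw [div_pow, div_div]
        ring

theorem exists_eventually_norm_starCoeff_le (hl : l ≠ 0) (hh : h ∉ poleSet l) :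
    ∃ M : ℝ, 0 ≤ M ∧ ∀ᶠ h' in 𝓝 h, ∀ n, ‖starCoeff l h' n‖ ≤ M ^ n / (n.factorial : ℝ) ^ 2 := by
  have hgap := poleGap_pos hl hh
  have hcont : ContinuousAt (fun h' => ‖h'‖ / poleGap l h') h :=
    continuous_norm.continuousAt.div (continuous_poleGap l).continuousAt hgap.ne'
  refine ⟨‖h‖ / poleGap l h + 1, by positivity, ?_⟩
  filter_upwards [(isClosed_poleSet l).isOpen_compl.mem_nhds hh,
    hcont.eventually_lt_const (lt_add_one _)] with h' hh' hlt n
  have hgap' := poleGap_pos hl hh'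
  exact (norm_starCoeff_le hl hh' n).trans (by gcongr)

theorem differentiableOn_starCoeff (hl : l ≠ 0) (n : ℕ) :
    DifferentiableOn ℂ (fun h => starCoeff l h n) (poleSet l)ᶜ := fun h hh => by
  have hfactor (j : ℕ) : (l : ℂ) - j * h ≠ 0 := norm_pos_iff.1 <|
    (mul_pos (poleGap_pos hl hh) j.cast_add_one_pos).trans_le (poleGap_mul_le l h j)
  refine DifferentiableAt.differentiableWithinAt <| .fun_div (by fun_prop) (by fun_prop) ?_
  exact mul_ne_zero (Nat.cast_ne_zero.2 n.factorial_ne_zero)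
    (Finset.prod_ne_zero_iff.2 fun j _ => hfactor j)

end Coefficients

/-! ## Descent to the sphere -/

theorem psi_surjective (l : ℝ) : Function.Surjective (psi l) := by
  rintro ⟨_, k, rfl⟩
  exact ⟨k, rfl⟩

theorem pull_injective (l : ℝ) : Function.Injective (pull l) :=
  (psi_surjective l).injective_comp_right

theorem psi_apply (l : ℝ) (k : SU2) :
    (psi l k).1 = (Complex.I * l / 8) • !![fA k, 2 * fC k; 2 * fB k, -fA k] := by
  have hinv : ((k⁻¹ : SU2) : Matrix (Fin 2) (Fin 2) ℂ) = k.1.adjugate :=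
    conjTranspose_eq_adjugate k
  change k.1 * basePoint l * ((k⁻¹ : SU2) : Matrix (Fin 2) (Fin 2) ℂ) = _
  rw [hinv, basePoint, Matrix.adjugate_fin_two, k.apply_zero_one, k.apply_one_one]
  ext i j
  fin_cases i <;> fin_cases j <;>
    simp [Matrix.mul_apply, Fin.sum_univ_two, fA, fB, fC, coord, k.apply_zero_one,
      k.apply_one_one] <;> ring

theorem entry_mem_range_pull (l : ℝ) (i j : Fin 2) :
    (fun k => (psi l k).1 i j) ∈ ((pull l).comp (Pol l).val).range :=
  ⟨⟨fun x => x.1 i j, Algebra.subset_adjoin ⟨Matrix.entryLinearMap ℝ ℂ i j, fun _ => rfl⟩⟩, rfl⟩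

theorem pullPol_injective (l : ℝ) : Function.Injective (pullPol l) := fun _ _ h =>
  Subtype.ext (pull_injective l (congrArg Subtype.val h))

section Descent

variable {l : ℝ}

theorem pullPol_surjective (hl : l ≠ 0) : Function.Surjective (pullPol l) := by
  have hgen (f : SU2 → ℂ) (i j : Fin 2) (c : ℂ) (hc : c ≠ 0)
      (hf : ∀ k, (psi l k).1 i j = c * f k) : f ∈ ((pull l).comp (Pol l).val).range := by
    have : f = c⁻¹ • fun k => (psi l k).1 i j := by
      funext k
      rw [Pi.smul_apply, hf, smul_eq_mul, inv_mul_cancel_left₀ hc]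
    rw [this]
    exact Subalgebra.smul_mem _ (entry_mem_range_pull l i j) _
  rintro ⟨f, hf⟩
  suffices f ∈ ((pull l).comp (Pol l).val).range from this.imp fun p hp => Subtype.ext hp
  refine Algebra.adjoin_le ?_ hf
  rintro f (rfl | rfl | rfl)
  · exact hgen fA 0 0 (Complex.I * l / 8) (by simp [hl]) fun k => by simp [psi_apply]
  · exact hgen fB 1 0 (Complex.I * l / 8 * 2) (by simp [hl]) fun k => by simp [psi_apply, mul_assoc]
  · exact hgen fC 0 1 (Complex.I * l / 8 * 2) (by simp [hl]) fun k => by simp [psi_apply, mul_assoc]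

/-- The isomorphism `p ↦ p ∘ ψ` between the polynomials on the sphere and the functions on `SU(2)`
generated by `A, B, C`. -/
def pullEquiv (hl : l ≠ 0) : Pol l ≃ₐ[ℂ] InvSU :=
  .ofBijective (pullPol l) ⟨pullPol_injective l, pullPol_surjective hl⟩

/-- The polynomial on the sphere obtained from an invariant polynomial on `ℂ²` by reduction. -/
def descend (hl : l ≠ 0) : InvC2 →ₐ[ℂ] Pol l :=
  (pullEquiv hl).symm.toAlgHom.comp restrictInv

theorem pull_descend (hl : l ≠ 0) (P : InvC2) : pull l (descend hl P) = restrict P :=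
  congrArg Subtype.val ((pullEquiv hl).apply_symm_apply (restrictInv P))

theorem descend_surjective (hl : l ≠ 0) : Function.Surjective (descend hl) :=
  (pullEquiv hl).symm.surjective.comp restrictInv_surjective

/-- The bidifferential operator `polyStar c` on the invariant polynomials on `ℂ²`. -/
def invStar (c : ℕ → ℂ) : InvC2 →ₗ[ℂ] InvC2 →ₗ[ℂ] InvC2 :=
  .mk₂ ℂ (fun P Q => ⟨polyStar c P Q, polyStar_mem_InvC2 c P.2 Q.2⟩)
    (fun P P' Q => Subtype.ext (LinearMap.map_add₂ _ P.1 P'.1 Q.1))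
    (fun a P Q => Subtype.ext (LinearMap.map_smul₂ _ a P.1 Q.1))
    (fun P Q Q' => Subtype.ext (map_add (polyStar c P.1) Q.1 Q'.1))
    (fun a P Q => Subtype.ext (map_smul (polyStar c P.1) a Q.1))

theorem starLift_descend_apply (hl : l ≠ 0) (h : ℂ) (P Q : InvC2) {N : ℕ}
    (hN : P.1.totalDegree < N) (k : SU2) :
    starLift l h (descend hl P) (descend hl Q) k =
      ∑ n ∈ Finset.range N, starCoeff l h n * restrict ((polyY ^ n) P.1 * (polyX ^ n) Q.1) k := by
  simp only [starLift, pull_descend, leftX_iterate_restrict, leftY_iterate_restrict, map_mul,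
    Pi.mul_apply, mul_assoc]
  refine tsum_eq_sum fun n hn => ?_
  rw [polyY_pow_eq_zero (hN.trans_le (not_lt.1 (Finset.mem_range.not.1 hn))), map_zero,
    Pi.zero_apply, zero_mul, mul_zero]

theorem pull_descend_invStar (hl : l ≠ 0) (h : ℂ) (P Q : InvC2) :
    pull l (descend hl (invStar (starCoeff l h) P Q)) =
      starLift l h (descend hl P) (descend hl Q) := by
  funext k
  rw [starLift_descend_apply hl h P Q (Nat.lt_succ_self _) k, pull_descend]
  change restrict (polyStar (starCoeff l h) P.1 Q.1) k = _
  rw [polyStar_eq_sum _ _ _ (Nat.lt_succ_self _), map_sum, Finset.sum_apply]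
  simp only [map_smul, Pi.smul_apply, smul_eq_mul]

theorem pull_starProd (hl : l ≠ 0) (h : ℂ) (p q : Pol l) :
    pull l (starProd l h p q) = starLift l h p q := by
  obtain ⟨P, rfl⟩ := descend_surjective hl p
  obtain ⟨Q, rfl⟩ := descend_surjective hl q
  have hr : ∃ r : Pol l, pull l r = starLift l h (descend hl P) (descend hl Q) :=
    ⟨_, pull_descend_invStar hl h P Q⟩
  rw [starProd, dif_pos hr]
  exact hr.choose_spec

theorem starProd_descend (hl : l ≠ 0) (h : ℂ) (P Q : InvC2) :
    starProd l h (descend hl P) (descend hl Q) = descend hl (invStar (starCoeff l h) P Q) :=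
  Subtype.ext <| pull_injective l <|
    (pull_starProd hl h _ _).trans (pull_descend_invStar hl h P Q).symm

theorem starProd_add_left (hl : l ≠ 0) (h : ℂ) (p p' q : Pol l) :
    starProd l h (p + p') q = starProd l h p q + starProd l h p' q := by
  obtain ⟨P, rfl⟩ := descend_surjective hl p
  obtain ⟨P', rfl⟩ := descend_surjective hl p'
  obtain ⟨Q, rfl⟩ := descend_surjective hl q
  simp only [← map_add, starProd_descend, LinearMap.map_add₂]

theorem starProd_add_right (hl : l ≠ 0) (h : ℂ) (p q q' : Pol l) :
    starProd l h p (q + q') = starProd l h p q + starProd l h p q' := by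
  obtain ⟨P, rfl⟩ := descend_surjective hl p
  obtain ⟨Q, rfl⟩ := descend_surjective hl q
  obtain ⟨Q', rfl⟩ := descend_surjective hl q'
  simp only [← map_add, starProd_descend]

theorem differentiableOn_starProd_apply (hl : l ≠ 0) (p q : Pol l) (x : Sphere l) :
    DifferentiableOn ℂ (fun h => (starProd l h p q).1 x) (poleSet l)ᶜ := by
  obtain ⟨P, rfl⟩ := descend_surjective hl p
  obtain ⟨Q, rfl⟩ := descend_surjective hl q
  obtain ⟨k, rfl⟩ := psi_surjective l x
  have hsum (h : ℂ) := (congrFun (pull_starProd hl h (descend hl P) (descend hl Q)) k).trans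
    (starLift_descend_apply hl h P Q (Nat.lt_succ_self _) k)
  refine DifferentiableOn.congr (.fun_sum fun n _ => ?_) fun h _ => hsum h
  exact (differentiableOn_starCoeff hl n).mul_const _

end Descent

/-! ## The reduction topology and its completion -/

theorem hasBasis_nhds_zero_trTopology (R : ℝ) :
    (@nhds PolC2 (trTopology R) 0).HasBasis (fun i : Set.Ici (1 : ℝ) × ℝ => 0 < i.2)
      fun i => {P | trSeminorm R i.1 P < i.2} := by
  let _ : TopologicalSpace PolC2 := trTopology R
  have hs : WithSeminorms (trSeminorm R) := .mk rfl
  refine hs.hasBasis_zero_ball.to_hasBasis (fun ⟨s, ε⟩ hε => ?_) fun ⟨C, ε⟩ hε =>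
    ⟨({C}, ε), hε, by simp [Seminorm.ball_zero_eq]⟩
  obtain ⟨C, hC⟩ := s.exists_le
  refine ⟨(C, ε), hε, fun P hP => ?_⟩
  rw [Seminorm.mem_ball_zero]
  exact (Finset.sup_le fun C' hC' => trSeminorm_mono R (hC C' hC') : _ ≤ trSeminorm R C) P
    |>.trans_lt hP

theorem mul_lt_of_lt_div_add_one {a b ε : ℝ} (ha : 0 ≤ a) (hb : 0 ≤ b) (h : b < ε / (a + 1)) :
    a * b < ε := by
  have := (lt_div_iff₀ (by linarith)).1 h
  linarith

section Reduction

variable {l R : ℝ}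

theorem isOpenQuotientMap_descend (hl : l ≠ 0) (R : ℝ) :
    letI := subTopology R
    IsOpenQuotientMap fun P : InvC2 => PolTR.of l R (descend hl P) := by
  let _ : TopologicalSpace InvC2 := subTopology R
  have : IsTopologicalAddGroup InvC2 := isTopologicalAddGroup_sub R
  let φ : InvC2 →+ PolTR l R := (descend hl : InvC2 →+ Pol l)
  have hφ : Topology.IsQuotientMap φ := by
    refine ⟨⟨?_⟩, descend_surjective hl⟩
    let e : Pol l ≃ InvSU := (pullEquiv hl).toEquiv
    change (quotTopology R).induced e = (subTopology R).coinduced (e.symm ∘ restrictInv)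
    rw [← coinduced_compose, ← Equiv.coinduced_symm]
  exact AddMonoidHom.isOpenQuotientMap_of_isQuotientMap hφ

theorem hasBasis_nhds_zero_PolTR (hl : l ≠ 0) (R : ℝ) :
    (𝓝 (0 : PolTR l R)).HasBasis (fun i : Set.Ici (1 : ℝ) × ℝ => 0 < i.2) fun i =>
      (fun P : InvC2 => PolTR.of l R (descend hl P)) '' {P | trSeminorm R i.1 P < i.2} := by
  let _ : TopologicalSpace PolC2 := trTopology R
  let _ : TopologicalSpace InvC2 := subTopology R
  have hzero : PolTR.of l R (descend hl 0) = 0 := map_zero (descend hl)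
  rw [← hzero, ← (isOpenQuotientMap_descend hl R).map_nhds_eq, nhds_induced]
  exact ((hasBasis_nhds_zero_trTopology R).comap _).map _

theorem eventually_exists_descend_eq (hl : l ≠ 0) (C : Set.Ici (1 : ℝ)) {ε : ℝ} (hε : 0 < ε) :
    ∀ᶠ p in 𝓝 (0 : PolTR l R),
      ∃ P : InvC2, trSeminorm R C P < ε ∧ PolTR.of l R (descend hl P) = p :=
  (hasBasis_nhds_zero_PolTR hl R).mem_of_mem (i := (C, ε)) hε

/-- The star product `*_ħ` as a biadditive map for the reduction-`T_R`-topology. -/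
def starHom (hl : l ≠ 0) (R : ℝ) (h : ℂ) : PolTR l R →+ PolTR l R →+ PolTR l R :=
  .mk' (fun p => .mk' (starProd l h p.toPol) (starProd_add_right hl h p.toPol)) fun p p' =>
    AddMonoidHom.ext (starProd_add_left hl h p.toPol p'.toPol)

theorem exists_starHom_mem (hl : l ≠ 0) (hR : 0 ≤ R) {K : Set ℂ} {M : ℝ} (hM : 0 ≤ M)
    (hK : ∀ h ∈ K, ∀ n, ‖starCoeff l h n‖ ≤ M ^ n / (n.factorial : ℝ) ^ 2)
    {V : Set (PolTR l R)} (hV : V ∈ 𝓝 0) :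
    ∃ C : Set.Ici (1 : ℝ), ∃ ε > 0, ∀ P Q : InvC2, trSeminorm R C P * trSeminorm R C Q < ε →
      ∀ h ∈ K, starHom hl R h (.of l R (descend hl P)) (.of l R (descend hl Q)) ∈ V := by
  obtain ⟨⟨C, ε⟩, hε, hCV⟩ := (hasBasis_nhds_zero_PolTR hl R).mem_iff.1 hV
  obtain ⟨C', hC'⟩ := exists_trSeminorm_polyStar_le hR hM C
  refine ⟨C', ε / 2, half_pos hε, fun P Q hPQ h hh => hCV ?_⟩
  refine ⟨invStar (starCoeff l h) P Q, ?_, (starProd_descend hl h P Q).symm⟩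
  exact (hC' _ (hK h hh) P Q).trans_lt (by linarith)

theorem equicontinuous_starHom (hl : l ≠ 0) (hR : 0 ≤ R) {K : Set ℂ} {M : ℝ} (hM : 0 ≤ M)
    (hK : ∀ h ∈ K, ∀ n, ‖starCoeff l h n‖ ≤ M ^ n / (n.factorial : ℝ) ^ 2) :
    Equicontinuous fun (h : K) (z : PolTR l R × PolTR l R) => starHom hl R h z.1 z.2 := by
  have hsmall (C : Set.Ici (1 : ℝ)) (P : PolC2) {ε : ℝ} (hε : 0 < ε) :
      0 < ε / (trSeminorm R C P + 1) :=
    div_pos hε (add_pos_of_nonneg_of_pos (apply_nonneg _ _) one_pos)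
  refine equicontinuous_of_equicontinuousAt_zero₂ (fun h : K => starHom hl R h) ?_
    (fun p => ?_) (fun q => ?_)
  · refine equicontinuousAt_of_eventually_mem_nhds_zero (fun h => by simp) fun V hV => ?_
    obtain ⟨C, ε, hε, hV⟩ := exists_starHom_mem hl hR hM hK hV
    have hp := eventually_exists_descend_eq (R := R) hl C hε
    have hq := eventually_exists_descend_eq (R := R) hl C one_pos
    rw [nhds_prod_eq]
    filter_upwards [hp.prod_mk hq]
    rintro ⟨_, _⟩ ⟨⟨P, hP, rfl⟩, Q, hQ, rfl⟩ h
    exact hV P Q (by nlinarith [apply_nonneg (trSeminorm R C) Q.1]) h h.2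
  · obtain ⟨P, rfl⟩ := descend_surjective hl p
    refine equicontinuousAt_of_eventually_mem_nhds_zero (fun h => map_zero _) fun V hV => ?_
    obtain ⟨C, ε, hε, hV⟩ := exists_starHom_mem hl hR hM hK hV
    filter_upwards [eventually_exists_descend_eq hl C (hsmall C P.1 hε)]
    rintro _ ⟨Q, hQ, rfl⟩ h
    exact hV P Q (mul_lt_of_lt_div_add_one (apply_nonneg _ _) (apply_nonneg _ _) hQ) h h.2
  · obtain ⟨Q, rfl⟩ := descend_surjective hl q
    refine equicontinuousAt_of_eventually_mem_nhds_zero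
      (fun h => DFunLike.congr_fun (map_zero (starHom hl R h)) _) fun V hV => ?_
    obtain ⟨C, ε, hε, hV⟩ := exists_starHom_mem hl hR hM hK hV
    filter_upwards [eventually_exists_descend_eq hl C (hsmall C Q.1 hε)]
    rintro _ ⟨P, hP, rfl⟩ h
    refine hV P Q ?_ h h.2
    exact mul_comm (trSeminorm R C P.1) _ ▸
      mul_lt_of_lt_div_add_one (apply_nonneg _ _) (apply_nonneg _ _) hP

/-- Evaluation at `x` as an additive map for the reduction-`T_R`-topology. -/
def evalHom (l R : ℝ) (x : Sphere l) : PolTR l R →+ ℂ :=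
  .mk' (fun p => p.toPol.1 x) fun _ _ => rfl

theorem continuous_evalHom (hl : l ≠ 0) (hR : 0 ≤ R) (x : Sphere l) :
    Continuous (evalHom l R x) := by
  obtain ⟨k, rfl⟩ := psi_surjective l x
  refine continuous_of_continuousAt_zero _ (Metric.tendsto_nhds.2 fun ε hε => ?_)
  filter_upwards [eventually_exists_descend_eq hl ⟨1, Set.self_mem_Ici⟩ hε]
  rintro _ ⟨P, hP, rfl⟩
  rw [map_zero, dist_zero_right]
  calc ‖pull l (descend hl P) k‖ = ‖restrict P k‖ := by rw [pull_descend]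
    _ ≤ _ := norm_restrict_le hR k P
    _ < ε := hP

theorem evalHat_toHat (hl : l ≠ 0) (hR : 0 ≤ R) (x : Sphere l) (p : Pol l) :
    evalHat l R x (toHat l R p) = p.1 x :=
  Completion.isDenseInducing_coe.extend_eq (continuous_evalHom hl hR x) (PolTR.of l R p)

theorem uniformContinuous_evalHat (hl : l ≠ 0) (hR : 0 ≤ R) (x : Sphere l) :
    UniformContinuous (evalHat l R x) := by
  have hx := uniformContinuous_addMonoidHom_of_continuous (continuous_evalHom hl hR x)
  have hext : evalHat l R x = Completion.extension (evalHom l R x) :=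
    Completion.isDenseInducing_coe.extend_unique (Completion.extension_coe hx)
      Completion.continuous_extension
  rw [hext]
  exact Completion.uniformContinuous_extension

theorem exists_isOpen_equicontinuous_starHom (hl : l ≠ 0) (hR : 0 ≤ R) {h : ℂ}
    (hh : h ∉ poleSet l) : ∃ U ⊆ (poleSet l)ᶜ, IsOpen U ∧ h ∈ U ∧
      Equicontinuous fun (h' : U) (z : PolTR l R × PolTR l R) => starHom hl R h' z.1 z.2 := by
  obtain ⟨M, hM, hbound⟩ := exists_eventually_norm_starCoeff_le hl hh
  have hpole : ∀ᶠ h' in 𝓝 h, h' ∈ (poleSet l)ᶜ := (isClosed_poleSet l).isOpen_compl.mem_nhds hh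
  obtain ⟨U, hU, hUo, hhU⟩ := _root_.mem_nhds_iff.1 (hpole.and hbound)
  exact ⟨U, fun h' hh' => (hU hh').1, hUo, hhU,
    equicontinuous_starHom hl hR hM fun h' hh' => (hU hh').2⟩

theorem starHat_toHat (hl : l ≠ 0) (hR : 0 ≤ R) {h : ℂ} (hh : h ∉ poleSet l) (p q : Pol l) :
    starHat l R h (toHat l R p) (toHat l R q) = toHat l R (starProd l h p q) := by
  obtain ⟨U, -, -, hhU, hU⟩ := exists_isOpen_equicontinuous_starHom (R := R) hl hR hh
  exact (isDenseInducing_coe_prodMap _ _).extend_eq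
    ((Completion.continuous_coe _).comp (hU.continuous ⟨h, hhU⟩)) (PolTR.of l R p, PolTR.of l R q)

theorem equicontinuous_starHat (hl : l ≠ 0) {U : Set ℂ}
    (hU : Equicontinuous fun (h : U) (z : PolTR l R × PolTR l R) => starHom hl R h z.1 z.2) :
    Equicontinuous fun (h : U) (z : PolHat l R × PolHat l R) => starHat l R h z.1 z.2 :=
  equicontinuous_extend_completion (fun h : U => (starHom hl R h).compr₂ Completion.toCompl)
    ((Completion.isUniformInducing_coe _).equicontinuous_iff.1 hU)

theorem continuous_starHat (hl : l ≠ 0) (hR : 0 ≤ R) {h : ℂ} (hh : h ∉ poleSet l) :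
    Continuous fun z : PolHat l R × PolHat l R => starHat l R h z.1 z.2 := by
  obtain ⟨U, -, -, hhU, hU⟩ := exists_isOpen_equicontinuous_starHom (R := R) hl hR hh
  exact (equicontinuous_starHat hl hU).continuous ⟨h, hhU⟩

theorem differentiableOn_evalHat_starHat (hl : l ≠ 0) (hR : 0 ≤ R) (p q : PolHat l R)
    (x : Sphere l) :
    DifferentiableOn ℂ (fun h => evalHat l R x (starHat l R h p q)) (poleSet l)ᶜ := by
  intro h hh
  obtain ⟨U, hUpole, hUo, hhU, hU⟩ := exists_isOpen_equicontinuous_starHom (R := R) hl hR hh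
  have hE : Equicontinuous fun (h' : U) (z : PolHat l R × PolHat l R) =>
      evalHat l R x (starHat l R h' z.1 z.2) := fun z V hV =>
    equicontinuous_starHat hl hU z _ (uniformContinuous_evalHat hl hR x hV)
  have hdense := (isDenseInducing_coe_prodMap (PolTR l R) (PolTR l R)).dense
  have hdiff : ∀ z ∈ Set.range (Prod.map (↑) (↑) : PolTR l R × PolTR l R → _), DifferentiableOn ℂ
      (fun h' => evalHat l R x (starHat l R h' z.1 z.2)) U := by
    rintro _ ⟨⟨p, q⟩, rfl⟩
    refine ((differentiableOn_starProd_apply hl p.toPol q.toPol x).mono hUpole).congr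
      fun h' hh' => ?_
    exact (congrArg (evalHat l R x) (starHat_toHat hl hR (hUpole hh') _ _)).trans
      (evalHat_toHat hl hR x _)
  exact ((differentiableOn_of_equicontinuous hUo hE hdense hdiff (p, q)).differentiableAt
    (hUo.mem_nhds hhU)).differentiableWithinAt

end Reduction

theorem theorem5p19_general (l R : ℝ) (hl : l ≠ 0) (hR : 0 ≤ R) :
    (∀ h ∈ (poleSet l)ᶜ,
      (∀ p q : Pol l, pull l (starProd l h p q) = starLift l h p q) ∧
      (∀ p q : Pol l,
        starHat l R h (toHat l R p) (toHat l R q) = toHat l R (starProd l h p q)) ∧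
      Continuous fun pq : PolHat l R × PolHat l R => starHat l R h pq.1 pq.2) ∧
    (∀ x : Sphere l,
      (∀ p : Pol l, evalHat l R x (toHat l R p) = (p : _ → ℂ) x) ∧
      Continuous (evalHat l R x)) ∧
    ∀ (p q : PolHat l R) (x : Sphere l),
      DifferentiableOn ℂ (fun h : ℂ => evalHat l R x (starHat l R h p q)) (poleSet l)ᶜ :=
  ⟨fun _ hh => ⟨pull_starProd hl _, starHat_toHat hl hR hh, continuous_starHat hl hR hh⟩,
    fun x => ⟨evalHat_toHat hl hR x, (uniformContinuous_evalHat hl hR x).continuous⟩,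
    differentiableOn_evalHat_starHat hl hR⟩

end QuantumSphere

end

theorem theorem5p19 (l R : ℝ) (hl : 0 < l) (hR : 0 ≤ R) :
    (∀ h ∈ (QuantumSphere.poleSet l)ᶜ,
      (∀ p q : QuantumSphere.Pol l,
        QuantumSphere.pull l (QuantumSphere.starProd l h p q) =
          QuantumSphere.starLift l h p q) ∧
      (∀ p q : QuantumSphere.Pol l,
        QuantumSphere.starHat l R h (QuantumSphere.toHat l R p) (QuantumSphere.toHat l R q) =
          QuantumSphere.toHat l R (QuantumSphere.starProd l h p q)) ∧
      Continuous fun pq : QuantumSphere.PolHat l R × QuantumSphere.PolHat l R =>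
        QuantumSphere.starHat l R h pq.1 pq.2) ∧
    (∀ x : QuantumSphere.Sphere l,
      (∀ p : QuantumSphere.Pol l,
        QuantumSphere.evalHat l R x (QuantumSphere.toHat l R p) = (p : _ → ℂ) x) ∧
      Continuous (QuantumSphere.evalHat l R x)) ∧
    ∀ (p q : QuantumSphere.PolHat l R) (x : QuantumSphere.Sphere l),
      DifferentiableOn ℂ
        (fun h : ℂ => QuantumSphere.evalHat l R x (QuantumSphere.starHat l R h p q))
        (QuantumSphere.poleSet l)ᶜ :=
  QuantumSphere.theorem5p19_general l R hl.ne' hR
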